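/- \textbf{Setting.} Let $\mathcal S$ be a finite set of tasks, $\mathcal X$ a context space with context distribution $P_{\mathsf x}$, $\mathcal A$ a finite action set and $\phi:\mathcal X\times\mathcal A\to\mathbb R^d$ a feature map with $\|\phi(x,a)\|_2\le 1$ for all $x,a$. Let $\Sigma_q,\Sigma_0\in\mathbb R^{d\times d}$ be positive definite, $\mu_q\in\mathbb R^d$, $\sigma>0$. The hyper-parameter is $\mu_*\sim\mathcal N(\mu_q,\Sigma_q)$; given $\mu_*$, the task parameters $\theta_{s,*}\sim\mathcal N(\mu_*,\Sigma_0)$, $s\in\mathcal S$, are i.i.d.; the reward of action $a$ in context $x$ of task $s$ is $\mathcal N(\phi(x,a)^\top\theta_{s,*},\sigma^2)$. The value of a policy $\pi:\mathcal X\to\mathcal A$ is $V(\pi;\theta)=\mathbb E_{X\sim P_{\mathsf x}}[\phi(X,\pi(X))^\top\theta]$, and $\pi_{s,*}=\arg\max_\pi V(\pi;\theta_{s,*})$ is the optimal policy of task $s$, a function of $\theta_{s,*}$. For a symmetric matrix, $\lambda_1$ and $\lambda_d$ are the largest and the smallest eigenvalue. Fix a logged dataset $\mathcal D=\{(S_t,X_t,A_t,Y_t)\}_{t=1}^n$.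 For $s\in\mathcal S$ let $n_s=\sum_t\mathbb 1\{S_t=s\}$, $$G_s=\sigma^{-2}\sum_t\mathbb 1\{S_t=s\}\,\phi(X_t,A_t)\phi(X_t,A_t)^\top,\qquad B_s=\sigma^{-2}\sum_t\mathbb 1\{S_t=s\}\,\phi(X_t,A_t)Y_t ,$$ $$\tilde\Sigma_s=(\Sigma_0^{-1}+G_s)^{-1},\qquad \bar\Sigma=\Big(\Sigma_q^{-1}+\sum_{z\in\mathcal S}(\Sigma_0+G_z^{-1})^{-1}\Big)^{-1},\qquad \bar\mu=\bar\Sigma\Big(\Sigma_q^{-1}\mu_q+\sum_{z\in\mathcal S}(\Sigma_0+G_z^{-1})^{-1}G_z^{-1}B_z\Big),$$ where for singular $G_z$ one reads $(\Sigma_0+G_z^{-1})^{-1}$ as $(I+G_z\Sigma_0)^{-1}G_z$ and $(\Sigma_0+G_z^{-1})^{-1}G_z^{-1}B_z$ as $(I+G_z\Sigma_0)^{-1}B_z$ (these agree with the displayed expressions for invertible $G_z$). HierOPO with parameter $\alpha$ outputs policies $\hat\pi_s(x)\in\arg\max_{a\in\mathcal A}L_s(x,a)$, where $$L_s(x,a)=\phi(x,a)^\top\tilde\Sigma_s(\Sigma_0^{-1}\bar\mu+B_s)-\alpha\sqrt{\phi(x,a)^\top\hat\Sigma_s\,\phi(x,a)},\qquad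 \hat\Sigma_s=\tilde\Sigma_s+\tilde\Sigma_s\Sigma_0^{-1}\bar\Sigma\Sigma_0^{-1}\tilde\Sigma_s .$$ Let $G_{s,*}=\mathbb E_{X\sim P_{\mathsf x}}[\phi(X,\pi_{s,*}(X))\phi(X,\pi_{s,*}(X))^\top]$, a function of $\theta_{s,*}$. Let $\gamma>0$ be such that $G_s\succeq\gamma\sigma^{-2}n_sG_{s,*}$ for every task $s\in\mathcal S$ and every value of $\theta_{s,*}\in\mathbb R^d$. \textbf{Theorem.} Let $\delta\in(0,1/e]$, $\alpha=\sqrt{5d\log(1/\delta)}$, let $\hat\pi$ be computed by HierOPO with this $\alpha$, and let $s\in\mathcal S$. Then $$\mathbb P\big(V(\pi_{s,*};\theta_{s,*})-V(\hat\pi_s;\theta_{s,*})\le\varepsilon\ \big|\ \mathcal D\big)\ \ge\ 1-\delta ,$$ where $\mathbb P(\cdot\mid\mathcal D)$ is the joint posterior of the parameters given the dataset and $$\varepsilon=\alpha\sqrt{\frac{4d}{\lambda_d(\Sigma_0^{-1})+\gamma\sigma^{-2}n_s}}+\alpha\sqrt{\frac{4d}{\lambda_d(\Sigma_q^{-1})+\sum_{z\in\mathcal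 S}\frac{1}{\lambda_1(\Sigma_0)+\gamma^{-1}\sigma^2\lambda_1(G_{z,*}^{-1})n_z^{-1}}}} .$$ If moreover every $\phi(x,a)$ has at most one non-zero entry and $\Sigma_q,\Sigma_0$ are diagonal, then the same holds with $$\varepsilon=\alpha\sqrt{\frac{4d}{\lambda_d(\Sigma_0^{-1})+\gamma\sigma^{-2}n_s}}+\alpha\sqrt{\frac{4d}{\lambda_d(\Sigma_q^{-1})+\sum_{z\in\mathcal S}\frac{1}{\lambda_1(\Sigma_0)+\gamma^{-1}\sigma^2n_z^{-1}}}} .$$ A summand over $z$ is read as $1/\infty=0$ when $n_z=0$ or, in the first bound, when $G_{z,*}$ is singular. The first $\varepsilon$ is a function of the task parameters through the matrices $G_{z,*}$, and the event is taken under their joint posterior. -/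

import Mathlib

open MeasureTheory ProbabilityTheory
open scoped Matrix

noncomputable section

namespace HierOPO

/-- The parameter and feature space `ℝ^d` with the Euclidean norm. -/
abbrev Vec (d : ℕ) : Type := EuclideanSpace ℝ (Fin d)

/-- Maximum eigenvalue `λ₁(M)` (used for symmetric matrices only). -/
def lamMax {d : ℕ} (M : Matrix (Fin d) (Fin d) ℝ) : ℝ := sSup (spectrum ℝ M)

/-- Minimum eigenvalue `λ_d(M)` (used for symmetric matrices only). -/
def lamMin {d : ℕ} (M : Matrix (Fin d) (Fin d) ℝ) : ℝ := sInf (spectrum ℝ M)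

/-- The data of a multi-task contextual bandit with linear rewards, with a hierarchical Gaussian
prior: `μ_* ~ N(muQ, covQ)`, `θ_s ~ N(μ_*, cov0)` i.i.d. given `μ_*`,
`Y ~ N(⟨φ(x, a), θ_s⟩, σ²)`, and contexts drawn from `Px`. -/
structure Model (d : ℕ) (X A : Type*) [MeasurableSpace X] where
  /-- context distribution -/
  Px : Measure X
  /-- feature extractor -/
  φ : X → A → Vec d
  /-- hyper-prior mean -/
  muQ : Vec d
  /-- hyper-prior covariance -/
  covQ : Matrix (Fin d) (Fin d) ℝ
  /-- task prior covariance -/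
  cov0 : Matrix (Fin d) (Fin d) ℝ
  /-- reward noise (standard deviation) -/
  σ : ℝ

/-- A logged dataset `(S_t, X_t, A_t, Y_t)`, `t = 1, …, n`. -/
structure Dataset (S X A : Type*) where
  n : ℕ
  task : Fin n → S
  ctx : Fin n → X
  act : Fin n → A
  rew : Fin n → ℝ

section

variable {d : ℕ} {S X A : Type*} [Fintype S] [DecidableEq S] [MeasurableSpace X]

/-- Number `n_s` of interactions with task `s`. -/
def Dataset.count (D : Dataset S X A) (s : S) : ℕ :=
  (Finset.univ.filter fun t => D.task t = s).card

namespace Model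

/-- Mean reward `r(x, a; θ) = φ(x, a)ᵀ θ`. -/
def reward (M : Model d X A) (x : X) (a : A) (θ : Vec d) : ℝ := inner ℝ (M.φ x a) θ

/-- Value `V(π; θ) = E_{X ~ Px} [r(X, π(X); θ)]` of a policy. -/
def value (M : Model d X A) (π : X → A) (θ : Vec d) : ℝ := ∫ x, M.reward x (π x) θ ∂M.Px

/-- `π` maximizes the value under `θ` among all (measurable) deterministic policies. -/
def IsOptimal [MeasurableSpace A] (M : Model d X A) (π : X → A) (θ : Vec d) : Prop :=
  Measurable π ∧ ∀ π' : X → A, Measurable π' → M.value π' θ ≤ M.value π θ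

/-! ### Bayesian model -/

/-- Joint prior law of `(μ_*, (θ_s)_s)`: `μ_* ~ N(muQ, covQ)` and `θ_s = μ_* + Z_s` with
`Z_s ~ N(0, cov0)` independent of each other and of `μ_*`. -/
def prior (S : Type*) [Fintype S] (M : Model d X A) : Measure (Vec d × (S → Vec d)) :=
  ((multivariateGaussian M.muQ M.covQ).prod
    (Measure.pi fun _ : S => multivariateGaussian 0 M.cov0)).map
    fun p => (p.1, fun s => p.1 + p.2 s)

/-- Likelihood of the logged rewards given the task parameters. (The contexts, tasks and logged
actions do not depend on the parameters, so they contribute only a constant factor.) -/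
def likelihood (M : Model d X A) (D : Dataset S X A) (θ : S → Vec d) : ENNReal :=
  ∏ t, gaussianPDF (M.reward (D.ctx t) (D.act t) (θ (D.task t))) (Real.toNNReal (M.σ ^ 2)) (D.rew t)

/-- Joint posterior law of `(μ_*, (θ_s)_s)` given the dataset, by Bayes' formula. -/
def posterior (M : Model d X A) (D : Dataset S X A) : Measure (Vec d × (S → Vec d)) :=
  (∫⁻ p, M.likelihood D p.2 ∂(M.prior S))⁻¹ •
    (M.prior S).withDensity fun p => M.likelihood D p.2

/-! ### The algorithm -/

/-- `G_s = σ⁻² ∑_t 1{S_t = s} φ(X_t, A_t) φ(X_t, A_t)ᵀ`. -/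
def gram (M : Model d X A) (D : Dataset S X A) (s : S) : Matrix (Fin d) (Fin d) ℝ :=
  (M.σ ^ 2)⁻¹ • ∑ t, if D.task t = s then
    Matrix.vecMulVec (M.φ (D.ctx t) (D.act t)).ofLp (M.φ (D.ctx t) (D.act t)).ofLp else 0

/-- `B_s = σ⁻² ∑_t 1{S_t = s} φ(X_t, A_t) Y_t`. -/
def bvec (M : Model d X A) (D : Dataset S X A) (s : S) : Fin d → ℝ :=
  (M.σ ^ 2)⁻¹ • ∑ t, if D.task t = s then D.rew t • (M.φ (D.ctx t) (D.act t)).ofLp else 0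

/-- Conditional task posterior covariance `(Σ₀⁻¹ + G_s)⁻¹`. -/
def covTask (M : Model d X A) (D : Dataset S X A) (s : S) : Matrix (Fin d) (Fin d) ℝ :=
  (M.cov0⁻¹ + M.gram D s)⁻¹

/-- Hyper-posterior covariance `(Σ_q⁻¹ + ∑_s (Σ₀ + G_s⁻¹)⁻¹)⁻¹`. The summand is written as
`(1 + G_s Σ₀)⁻¹ G_s`, which is the same matrix when `G_s` is invertible (see `info_eq`) and is
its correct value also when `G_s` is singular. -/
def covHyper (M : Model d X A) (D : Dataset S X A) : Matrix (Fin d) (Fin d) ℝ :=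
  (M.covQ⁻¹ + ∑ s, (1 + M.gram D s * M.cov0)⁻¹ * M.gram D s)⁻¹

/-- Hyper-posterior mean, the hyper-posterior covariance applied to
`Σ_q⁻¹ μ_q + ∑_s (Σ₀ + G_s⁻¹)⁻¹ G_s⁻¹ B_s`. The summand is written as `(1 + G_s Σ₀)⁻¹ B_s`,
for the same reason (see `info_mulVec_eq`). -/
def meanHyper (M : Model d X A) (D : Dataset S X A) : Fin d → ℝ :=
  M.covHyper D *ᵥ (M.covQ⁻¹ *ᵥ M.muQ.ofLp + ∑ s, (1 + M.gram D s * M.cov0)⁻¹ *ᵥ M.bvec D s)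

/-- Posterior mean of the task parameter, `Σ̃_s (Σ₀⁻¹ μ̄ + B_s)`. -/
def meanPost (M : Model d X A) (D : Dataset S X A) (s : S) : Fin d → ℝ :=
  M.covTask D s *ᵥ (M.cov0⁻¹ *ᵥ M.meanHyper D + M.bvec D s)

/-- Posterior covariance of the task parameter, `Σ̃_s + Σ̃_s Σ₀⁻¹ Σ̄ Σ₀⁻¹ Σ̃_s`. -/
def covPost (M : Model d X A) (D : Dataset S X A) (s : S) : Matrix (Fin d) (Fin d) ℝ :=
  M.covTask D s + M.covTask D s * M.cov0⁻¹ * M.covHyper D * M.cov0⁻¹ * M.covTask D s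

/-- Lower confidence bound
`L_s(x, a) = φ(x, a)ᵀ θ̂_s - α √(φ(x, a)ᵀ Σ̂_s φ(x, a))`. -/
def lcb (M : Model d X A) (D : Dataset S X A) (α : ℝ) (s : S) (x : X) (a : A) : ℝ :=
  (M.φ x a).ofLp ⬝ᵥ M.meanPost D s
    - α * √((M.φ x a).ofLp ⬝ᵥ (M.covPost D s *ᵥ (M.φ x a).ofLp))

/-- `πhat` is an output of HierOPO with parameter `α`: a (measurable) task-conditioned policy that
plays a maximizer of the lower confidence bound in every task and context. -/
def IsHierOPO [MeasurableSpace A] (M : Model d X A) (D : Dataset S X A) (α : ℝ)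
    (πhat : S → X → A) : Prop :=
  ∀ s, Measurable (πhat s) ∧ ∀ x a, M.lcb D α s x a ≤ M.lcb D α s x (πhat s x)

/-! ### Assumptions and bounds -/

/-- `E_{X ~ Px} [φ(X, π(X)) φ(X, π(X))ᵀ]`. For `π` the optimal policy of `θ_s` this is
`G_{s,*}`. -/
def popGram (M : Model d X A) (π : X → A) : Matrix (Fin d) (Fin d) ℝ :=
  Matrix.of fun i j => ∫ x, M.φ x (π x) i * M.φ x (π x) j ∂M.Px

/-- The dataset is well explored with constant `γ > 0`: `G_s ⪰ γ σ⁻² n_s G_{s,*}` for every task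
`s` and every value `θ` of its parameter; `πstar θ` is the optimal policy under `θ`. -/
def WellExplored (M : Model d X A) (D : Dataset S X A) (πstar : Vec d → X → A) (γ : ℝ) : Prop :=
  0 < γ ∧ ∀ (s : S) (θ : Vec d),
    (M.gram D s - (γ * (M.σ ^ 2)⁻¹ * D.count s) • M.popGram (πstar θ)).PosSemidef

/-- Every feature vector has at most one non-zero entry, and both prior covariances are
diagonal. -/
def DiagonalCase (M : Model d X A) : Prop :=
  (∀ x a i j, M.φ x a i ≠ 0 → M.φ x a j ≠ 0 → i = j) ∧ M.covQ.IsDiag ∧ M.cov0.IsDiag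

/-- Task term `α √(4 d / (λ_d(Σ₀⁻¹) + γ σ⁻² n_s))`. -/
def taskTerm (M : Model d X A) (D : Dataset S X A) (α γ : ℝ) (s : S) : ℝ :=
  α * √(4 * d / (lamMin M.cov0⁻¹ + γ * (M.σ ^ 2)⁻¹ * D.count s))

/-- Hyper-parameter term
`α √(4 d / (λ_d(Σ_q⁻¹) + ∑_z 1 / (λ₁(Σ₀) + γ⁻¹ σ² λ₁(G_{z,*}⁻¹) n_z⁻¹)))`, where
`G_{z,*}` is taken at the task parameters `θ`. A summand is `1 / ∞ = 0` when `n_z = 0` or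
`G_{z,*}` is singular. -/
def hyperTerm (M : Model d X A) (D : Dataset S X A) (πstar : Vec d → X → A) (α γ : ℝ)
    (θ : S → Vec d) : ℝ :=
  α * √(4 * d / (lamMin M.covQ⁻¹ + ∑ z,
    open Classical in
    if D.count z = 0 ∨ ¬ IsUnit (M.popGram (πstar (θ z))) then 0 else
      1 / (lamMax M.cov0
        + γ⁻¹ * M.σ ^ 2 * lamMax (M.popGram (πstar (θ z)))⁻¹ * (D.count z : ℝ)⁻¹)))

/-- Hyper-parameter term of the diagonal case,
`α √(4 d / (λ_d(Σ_q⁻¹) + ∑_z 1 / (λ₁(Σ₀) + γ⁻¹ σ² n_z⁻¹)))`. A summand is `1 / ∞ = 0` when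
`n_z = 0`. -/
def hyperTermDiag (M : Model d X A) (D : Dataset S X A) (α γ : ℝ) : ℝ :=
  α * √(4 * d / (lamMin M.covQ⁻¹ + ∑ z,
    if D.count z = 0 then 0 else
      1 / (lamMax M.cov0 + γ⁻¹ * M.σ ^ 2 * (D.count z : ℝ)⁻¹)))

end Model

end

/-- The matrix used in `Model.covHyper` is `(Σ₀ + G⁻¹)⁻¹` for invertible `G`. -/
theorem info_eq {d : ℕ} (G C : Matrix (Fin d) (Fin d) ℝ) (hG : IsUnit G.det) :
    (1 + G * C)⁻¹ * G = (C + G⁻¹)⁻¹ := by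
  have h : 1 + G * C = G * (C + G⁻¹) := by
    rw [mul_add, Matrix.mul_nonsing_inv G hG, add_comm]
  rw [h, Matrix.mul_inv_rev, mul_assoc, Matrix.nonsing_inv_mul G hG, mul_one]

/-- The vector used in `Model.meanHyper` is `(Σ₀ + G⁻¹)⁻¹ G⁻¹ b` for invertible `G`. -/
theorem info_mulVec_eq {d : ℕ} (G C : Matrix (Fin d) (Fin d) ℝ) (b : Fin d → ℝ)
    (hG : IsUnit G.det) :
    (1 + G * C)⁻¹ *ᵥ b = (C + G⁻¹)⁻¹ *ᵥ (G⁻¹ *ᵥ b) := by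
  rw [← info_eq G C hG, Matrix.mulVec_mulVec, mul_assoc, Matrix.mul_nonsing_inv G hG, mul_one]

end HierOPO

end

noncomputable section

namespace HierOPO

/-! Given the data, `θ_s` is Gaussian with mean `meanPost` and covariance `covPost`; write `V` for
`covPost`. This is proved at the level of moment generating functions: multiplying the likelihood by
`exp (u ⬝ θ_s)` only adds `u` to the information vector of task `s`, so integrating out first the
task parameters and then `μ_*` gives, for every `u`, the same constant times an explicit exponential
(`exists_lintegral_likelihood`). The normalizing constants cancel in Bayes' formula and are never
evaluated. Integrals take values in `ENNReal`, so no integrability has to be checked here.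

The moment generating function alone yields a chi-square tail, hence with probability `1 - δ` every
direction `v` satisfies `|v ⬝ (θ_s - mean)| ≤ α √(v ⬝ V v)` (`gaussian_concentration`). Uniformity
in `v` matters because the optimal policy depends on `θ_s`. On this event pessimism costs at most
`2α E √(φ ⬝ V φ)` along the optimal actions, and Jensen bounds this by `2α √(tr (V G_*))`
(`value_gap_le`). It remains to bound the trace.

In general `Σ₀⁻¹` and `G_s` do not commute, and `Σ₀⁻¹ Σ̃_s` need not be a contraction, so the two
summands of `V` are not bounded separately. `woodbury_posterior` rewrites `V` as the inverse of
`infoMat Σ₀⁻¹ P + G_s`, where `P` is the precision of `μ_*` coming from the hyper-prior and all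
tasks but `s`. Since `G_* ≤ 1` and `G_s ≥ c G_*`, this matrix dominates a multiple of `G_*`, which
bounds the trace; the scalar inequality `inv_parallel_add_le` then splits the result into the two
advertised terms. In the diagonal case everything commutes and the summands are bounded
coordinatewise. The diagonal entries of `G_*`, which weight the trace, absorb the factor
`λ₁(G_*⁻¹)`. -/

/-! ### Translations and quadratic exponentials under the standard Gaussian. -/

theorem lintegral_pi_prod {ι : Type*} [Fintype ι] {E : ι → Type*} [∀ i, MeasurableSpace (E i)]
    (μ : ∀ i, Measure (E i)) [∀ i, IsProbabilityMeasure (μ i)] (f : ∀ i, E i → ENNReal)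
    (hf : ∀ i, Measurable (f i)) :
    ∫⁻ x, ∏ i, f i (x i) ∂Measure.pi μ = ∏ i, ∫⁻ y, f i y ∂μ i := by
  have h := lintegral_prod_eq_prod_lintegral_of_indepFun (μ := Measure.pi μ) Finset.univ
    (fun i (x : ∀ i, E i) => f i (x i))
    (iIndepFun_pi (X := f) fun i => (hf i).aemeasurable)
    (fun i => (hf i).comp (measurable_pi_apply i))
  rw [h]
  refine Finset.prod_congr rfl fun i _ => ?_
  exact (measurePreserving_eval μ i).lintegral_comp (hf i)

theorem gaussianReal_eq_withDensity (w : ℝ) :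
    gaussianReal w 1 =
      (gaussianReal 0 1).withDensity fun x => ENNReal.ofReal (Real.exp (w * x - w * w / 2)) := by
  rw [gaussianReal_of_var_ne_zero _ one_ne_zero, gaussianReal_of_var_ne_zero _ one_ne_zero,
    ← withDensity_mul _ (measurable_gaussianPDF _ _) (by fun_prop)]
  congr 1
  funext x
  simp only [gaussianPDF, gaussianPDFReal, Pi.mul_apply]
  rw [← ENNReal.ofReal_mul (by positivity), mul_assoc _ (Real.exp _) (Real.exp _), ← Real.exp_add]
  congr 3
  simp only [NNReal.coe_one]
  ring

/-- The standard Gaussian measure on `Fin d → ℝ`. -/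
def stdPi (d : ℕ) : Measure (Fin d → ℝ) := Measure.pi fun _ => gaussianReal 0 1

instance (d : ℕ) : IsProbabilityMeasure (stdPi d) := by
  unfold stdPi; infer_instance

/-- The Cameron–Martin formula. Both sides are product measures, so it is enough to compare boxes,
where the one-dimensional density factors over coordinates. -/
theorem stdPi_map_add {d : ℕ} (w : Fin d → ℝ) :
    (stdPi d).map (fun x => x + w) =
      (stdPi d).withDensity fun x => ENNReal.ofReal (Real.exp (w ⬝ᵥ x - w ⬝ᵥ w / 2)) := by
  have h1 : (stdPi d).map (fun x => x + w) = Measure.pi fun i => gaussianReal (w i) 1 := by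
    have := Measure.pi_map_pi (μ := fun _ : Fin d => gaussianReal 0 1)
      (f := fun i x => x + w i) (fun i => by fun_prop)
    simp only [gaussianReal_map_add_const, zero_add] at this
    exact this
  rw [h1]
  refine Measure.pi_eq fun s hs => ?_
  rw [withDensity_apply _ (MeasurableSet.univ_pi hs), ← lintegral_indicator (MeasurableSet.univ_pi hs)]
  have h2 : ∀ x : Fin d → ℝ, (Set.univ.pi s).indicator
      (fun x => ENNReal.ofReal (Real.exp (w ⬝ᵥ x - w ⬝ᵥ w / 2))) x =
      ∏ i, (s i).indicator (fun y => ENNReal.ofReal (Real.exp (w i * y - w i * w i / 2))) (x i) := by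
    intro x
    by_cases hx : x ∈ Set.univ.pi s
    · rw [Set.indicator_of_mem hx]
      have : ∀ i, x i ∈ s i := fun i => hx i trivial
      simp only [Set.indicator_of_mem (this _)]
      rw [← ENNReal.ofReal_prod_of_nonneg (fun i _ => (Real.exp_pos _).le), ← Real.exp_sum,
        Finset.sum_sub_distrib, dotProduct, dotProduct, Finset.sum_div]
    · rw [Set.indicator_of_notMem hx]
      simp only [Set.mem_pi, Set.mem_univ, true_implies, not_forall] at hx
      obtain ⟨i, hi⟩ := hx
      exact (Finset.prod_eq_zero (Finset.mem_univ i) (Set.indicator_of_notMem hi _)).symm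
  simp_rw [h2]
  rw [stdPi, lintegral_pi_prod _ _ fun i => Measurable.indicator (by fun_prop) (hs i)]
  refine Finset.prod_congr rfl fun i _ => ?_
  rw [lintegral_indicator (hs i), gaussianReal_eq_withDensity (w i), withDensity_apply _ (hs i)]

theorem lintegral_stdPi_add {d : ℕ} (w : Fin d → ℝ) {f : (Fin d → ℝ) → ENNReal}
    (hf : Measurable f) :
    ∫⁻ x, f (x + w) ∂stdPi d =
      ∫⁻ x, ENNReal.ofReal (Real.exp (w ⬝ᵥ x - w ⬝ᵥ w / 2)) * f x ∂stdPi d := by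
  have hm : Measurable fun x : Fin d → ℝ =>
      ENNReal.ofReal (Real.exp (w ⬝ᵥ x - w ⬝ᵥ w / 2)) := by
    unfold dotProduct; fun_prop
  rw [← lintegral_map (f := f) hf (by fun_prop : Measurable fun x : Fin d → ℝ => x + w),
    stdPi_map_add, lintegral_withDensity_eq_lintegral_mul _ hm hf]
  rfl

/-- The exponential of a real number, as an extended nonnegative real. -/
def expE (r : ℝ) : ENNReal := ENNReal.ofReal (Real.exp r)

theorem expE_add (a b : ℝ) : expE (a + b) = expE a * expE b := by
  rw [expE, Real.exp_add, ENNReal.ofReal_mul (Real.exp_pos _).le]; rfl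

theorem expE_sum {ι : Type*} (s : Finset ι) (f : ι → ℝ) :
    expE (∑ i ∈ s, f i) = ∏ i ∈ s, expE (f i) := by
  rw [expE, Real.exp_sum, ENNReal.ofReal_prod_of_nonneg fun i _ => (Real.exp_pos _).le]; rfl

theorem expE_ne_zero (a : ℝ) : expE a ≠ 0 := by
  simp [expE, Real.exp_pos]

theorem expE_ne_top (a : ℝ) : expE a ≠ ⊤ := ENNReal.ofReal_ne_top

theorem expE_zero : expE 0 = 1 := by simp [expE]

theorem expE_mono {a b : ℝ} (h : a ≤ b) : expE a ≤ expE b :=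
  ENNReal.ofReal_le_ofReal (Real.exp_le_exp.2 h)

theorem measurable_expE : Measurable expE := by unfold expE; fun_prop

theorem measurable_expE_comp {Ω : Type*} [MeasurableSpace Ω] {f : Ω → ℝ} (hf : Measurable f) :
    Measurable fun x => expE (f x) := measurable_expE.comp hf

theorem measurable_dotProduct {ι Ω : Type*} [Fintype ι] [MeasurableSpace Ω] {f g : Ω → ι → ℝ}
    (hf : Measurable f) (hg : Measurable g) : Measurable fun x => f x ⬝ᵥ g x := by
  unfold dotProduct
  exact Finset.measurable_sum _ fun i _ =>
    ((measurable_pi_apply i).comp hf).mul ((measurable_pi_apply i).comp hg)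

theorem measurable_mulVec {ι κ Ω : Type*} [Fintype ι] [MeasurableSpace Ω] {f : Ω → ι → ℝ}
    (A : Matrix κ ι ℝ) (hf : Measurable f) : Measurable fun x => A *ᵥ f x :=
  measurable_pi_iff.2 fun _ => measurable_dotProduct measurable_const hf

theorem dotProduct_mulVec_symm {d : ℕ} {A : Matrix (Fin d) (Fin d) ℝ} (hA : A.IsHermitian)
    (x y : Fin d → ℝ) : x ⬝ᵥ A *ᵥ y = y ⬝ᵥ A *ᵥ x := by
  have hA' : Aᵀ = A := by simpa [Matrix.IsHermitian, Matrix.conjTranspose_eq_transpose_of_trivial] using hA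
  rw [Matrix.dotProduct_mulVec, ← Matrix.mulVec_transpose, hA', dotProduct_comm]

theorem mul_mulVec_dotProduct_symm {d : ℕ} {A B : Matrix (Fin d) (Fin d) ℝ} (hA : A.IsHermitian)
    (hB : B.IsHermitian) (x y : Fin d → ℝ) : ((A * B) *ᵥ x) ⬝ᵥ y = x ⬝ᵥ (B * A) *ᵥ y := by
  rw [← Matrix.mulVec_mulVec, ← Matrix.mulVec_mulVec, dotProduct_comm, dotProduct_mulVec_symm hA,
    dotProduct_comm, dotProduct_mulVec_symm hB]

theorem posDef_mul_inv {d : ℕ} {A : Matrix (Fin d) (Fin d) ℝ} (hA : A.PosDef) : A * A⁻¹ = 1 :=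
  Matrix.mul_nonsing_inv _ ((Matrix.isUnit_iff_isUnit_det _).1 hA.isUnit)

theorem posDef_inv_mul {d : ℕ} {A : Matrix (Fin d) (Fin d) ℝ} (hA : A.PosDef) : A⁻¹ * A = 1 :=
  Matrix.nonsing_inv_mul _ ((Matrix.isUnit_iff_isUnit_det _).1 hA.isUnit)

theorem posSemidef_quad_nonneg {d : ℕ} {A : Matrix (Fin d) (Fin d) ℝ} (hA : A.PosSemidef)
    (x : Fin d → ℝ) : 0 ≤ x ⬝ᵥ A *ᵥ x := by
  simpa using hA.dotProduct_mulVec_nonneg x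

/-- Completing the square: translating by `w = (1 + G)⁻¹ b` removes the linear term. The remaining
integral does not depend on `b` and stays unevaluated. -/
theorem lintegral_stdPi_quad {d : ℕ} {G : Matrix (Fin d) (Fin d) ℝ} (hG : G.PosSemidef)
    (b : Fin d → ℝ) :
    ∫⁻ x, expE (b ⬝ᵥ x - x ⬝ᵥ G *ᵥ x / 2) ∂stdPi d =
      (∫⁻ x, expE (-(x ⬝ᵥ G *ᵥ x / 2)) ∂stdPi d) * expE (b ⬝ᵥ (1 + G)⁻¹ *ᵥ b / 2) := by
  have hP : (1 + G).PosDef := Matrix.PosDef.one.add_posSemidef hG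
  set w := (1 + G)⁻¹ *ᵥ b with hw
  have hwb : w + G *ᵥ w = b := by
    have : (1 + G) *ᵥ w = b := by
      rw [hw, Matrix.mulVec_mulVec, posDef_mul_inv hP, Matrix.one_mulVec]
    rwa [Matrix.add_mulVec, Matrix.one_mulVec] at this
  have hmq : Measurable fun x : Fin d → ℝ => x ⬝ᵥ G *ᵥ x :=
    measurable_dotProduct measurable_id (measurable_mulVec G measurable_id)
  have hml : ∀ v : Fin d → ℝ, Measurable fun x : Fin d → ℝ => v ⬝ᵥ x :=
    fun v => measurable_dotProduct measurable_const measurable_id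
  have key := lintegral_stdPi_add w
    (f := fun x => expE (b ⬝ᵥ x - x ⬝ᵥ G *ᵥ x / 2 - (w ⬝ᵥ x - w ⬝ᵥ w / 2)))
    (measurable_expE_comp ((((hml b).sub (hmq.div_const 2))).sub ((hml w).sub_const _)))
  have hR : ∀ x : Fin d → ℝ, ENNReal.ofReal (Real.exp (w ⬝ᵥ x - w ⬝ᵥ w / 2)) *
      expE (b ⬝ᵥ x - x ⬝ᵥ G *ᵥ x / 2 - (w ⬝ᵥ x - w ⬝ᵥ w / 2)) =
      expE (b ⬝ᵥ x - x ⬝ᵥ G *ᵥ x / 2) := by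
    intro x
    change expE _ * _ = _
    rw [← expE_add]; congr 1; ring
  simp_rw [hR] at key
  have hmn : Measurable fun x : Fin d → ℝ => expE (-(x ⬝ᵥ G *ᵥ x / 2)) :=
    measurable_expE_comp (hmq.div_const 2).neg
  rw [← key, ← lintegral_mul_const _ hmn]
  refine lintegral_congr fun x => ?_
  rw [← expE_add]
  congr 1
  have e1 : x ⬝ᵥ G *ᵥ w = w ⬝ᵥ G *ᵥ x := dotProduct_mulVec_symm hG.1 _ _
  rw [← hwb, Matrix.mulVec_add]
  simp only [dotProduct_add, add_dotProduct]
  rw [dotProduct_comm (G *ᵥ w) x, dotProduct_comm (G *ᵥ w) w, e1]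
  ring

theorem lintegral_stdPi_exp {d : ℕ} (b : Fin d → ℝ) :
    ∫⁻ x, expE (b ⬝ᵥ x) ∂stdPi d = expE (b ⬝ᵥ b / 2) := by
  have := lintegral_stdPi_quad (Matrix.PosSemidef.zero (n := Fin d) (R := ℝ)) b
  simpa [expE_zero] using this

/-! ### Gaussian integrals with general mean and covariance. -/

theorem lintegral_multivariateGaussian {d : ℕ} (m : Vec d) (C : Matrix (Fin d) (Fin d) ℝ)
    {f : (Fin d → ℝ) → ENNReal} (hf : Measurable f) :
    ∫⁻ x, f x.ofLp ∂multivariateGaussian m C =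
      ∫⁻ x, f (m.ofLp + (open scoped MatrixOrder in CFC.sqrt C) *ᵥ x) ∂stdPi d := by
  have hf' : Measurable fun x : Vec d => f x.ofLp := hf.comp (by fun_prop)
  rw [multivariateGaussian, lintegral_map hf' (by fun_prop), ← map_pi_eq_stdGaussian,
    lintegral_map (by
      exact hf'.comp (by fun_prop)) (by fun_prop)]
  rfl

/-- The normalizing constant of a Gaussian likelihood with information matrix `G` under a centered
Gaussian with covariance `C`. -/
def gaussConst {d : ℕ} (C G : Matrix (Fin d) (Fin d) ℝ) : ENNReal :=
  ∫⁻ x, expE (-(x.ofLp ⬝ᵥ G *ᵥ x.ofLp / 2)) ∂multivariateGaussian (0 : Vec d) C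

theorem measurable_quad {d : ℕ} (G : Matrix (Fin d) (Fin d) ℝ) :
    Measurable fun x : Fin d → ℝ => x ⬝ᵥ G *ᵥ x :=
  measurable_dotProduct measurable_id (measurable_mulVec G measurable_id)

theorem gaussConst_ne_top {d : ℕ} (C : Matrix (Fin d) (Fin d) ℝ) {G : Matrix (Fin d) (Fin d) ℝ}
    (hG : G.PosSemidef) : gaussConst C G ≠ ⊤ := by
  refine ne_top_of_le_ne_top ENNReal.one_ne_top ?_
  calc gaussConst C G ≤ ∫⁻ _, 1 ∂multivariateGaussian (0 : Vec d) C := by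
        refine lintegral_mono fun x => ?_
        rw [← expE_zero]
        exact expE_mono (by have := posSemidef_quad_nonneg hG x.ofLp; linarith)
    _ = 1 := by simp

theorem gaussConst_ne_zero {d : ℕ} (C G : Matrix (Fin d) (Fin d) ℝ) : gaussConst C G ≠ 0 := by
  have hm : Measurable fun x : Vec d => expE (-(x.ofLp ⬝ᵥ G *ᵥ x.ofLp / 2)) :=
    measurable_expE_comp (((measurable_quad G).comp (by fun_prop)).div_const 2).neg
  unfold gaussConst
  rw [Ne, lintegral_eq_zero_iff hm]
  intro h
  have h1 : ∀ᵐ _ ∂multivariateGaussian (0 : Vec d) C, False := by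
    filter_upwards [h] with x hx
    exact expE_ne_zero _ hx
  rw [Filter.eventually_false_iff_eq_bot, ae_eq_bot] at h1
  exact IsProbabilityMeasure.ne_zero _ h1

/-- Substituting `x = R z` with `R = √C` reduces to the standard Gaussian with information matrix `R
G R`, and `R (1 + R G R)⁻¹ R = (C⁻¹ + G)⁻¹`. -/
theorem lintegral_gaussian_quad {d : ℕ} {C G : Matrix (Fin d) (Fin d) ℝ} (hC : C.PosDef)
    (hG : G.PosSemidef) (b : Fin d → ℝ) :
    ∫⁻ x, expE (b ⬝ᵥ x.ofLp - x.ofLp ⬝ᵥ G *ᵥ x.ofLp / 2) ∂multivariateGaussian (0 : Vec d) C =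
      gaussConst C G * expE (b ⬝ᵥ (C⁻¹ + G)⁻¹ *ᵥ b / 2) := by
  obtain ⟨R, hR, hRR, hRC⟩ : ∃ R : Matrix (Fin d) (Fin d) ℝ, R.IsHermitian ∧ R * R = C ∧
      R = (open scoped MatrixOrder in CFC.sqrt C) := by
    open scoped MatrixOrder in
    exact ⟨CFC.sqrt C, (Matrix.nonneg_iff_posSemidef.1 (CFC.sqrt_nonneg C)).1,
      CFC.sqrt_mul_sqrt_self _ hC.posSemidef.nonneg, rfl⟩
  have hG' : (R * G * R).PosSemidef := by
    have := hG.conjTranspose_mul_mul_same R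
    rwa [hR] at this
  have hquad : ∀ x : Fin d → ℝ, (R *ᵥ x) ⬝ᵥ G *ᵥ (R *ᵥ x) = x ⬝ᵥ (R * G * R) *ᵥ x := by
    intro x
    rw [← Matrix.mulVec_mulVec, ← Matrix.mulVec_mulVec, dotProduct_mulVec_symm hR x, dotProduct_comm]
  have hlin : ∀ x : Fin d → ℝ, b ⬝ᵥ R *ᵥ x = (R *ᵥ b) ⬝ᵥ x := by
    intro x
    rw [dotProduct_mulVec_symm hR, dotProduct_comm]
  have h1 : ∀ f : (Fin d → ℝ) → ENNReal, Measurable f →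
      ∫⁻ x, f x.ofLp ∂multivariateGaussian (0 : Vec d) C = ∫⁻ x, f (R *ᵥ x) ∂stdPi d := by
    intro f hf
    rw [lintegral_multivariateGaussian 0 C hf, ← hRC]
    simp
  have hml : Measurable fun x : Fin d → ℝ => b ⬝ᵥ x :=
    measurable_dotProduct measurable_const measurable_id
  rw [gaussConst, h1 (fun x => expE (b ⬝ᵥ x - x ⬝ᵥ G *ᵥ x / 2))
      (measurable_expE_comp (hml.sub ((measurable_quad G).div_const 2))),
    h1 (fun x => expE (-(x ⬝ᵥ G *ᵥ x / 2)))
      (measurable_expE_comp ((measurable_quad G).div_const 2).neg)]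
  simp_rw [hquad, hlin]
  rw [lintegral_stdPi_quad hG']
  congr 3
  have hRu : IsUnit R.det := by
    have h2 := (Matrix.isUnit_iff_isUnit_det _).1 hC.isUnit
    rw [← hRR, Matrix.det_mul] at h2
    exact isUnit_of_mul_isUnit_left h2
  have e1 : R * R⁻¹ = 1 := Matrix.mul_nonsing_inv R hRu
  have e2 : R⁻¹ * R = 1 := Matrix.nonsing_inv_mul R hRu
  have h3 : (C⁻¹ + G)⁻¹ = R * (1 + R * G * R)⁻¹ * R := by
    have h4 : C⁻¹ + G = R⁻¹ * (1 + R * G * R) * R⁻¹ := by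
      have h5 : R⁻¹ * (R * G * R) * R⁻¹ = (R⁻¹ * R) * G * (R * R⁻¹) := by
        simp only [Matrix.mul_assoc]
      rw [← hRR, Matrix.mul_inv_rev, Matrix.mul_add, Matrix.add_mul, Matrix.mul_one, h5, e1, e2,
        Matrix.one_mul, Matrix.mul_one]
    rw [h4, Matrix.mul_inv_rev, Matrix.mul_inv_rev, Matrix.nonsing_inv_nonsing_inv R hRu]
    simp only [Matrix.mul_assoc]
  rw [h3, ← Matrix.mulVec_mulVec, ← Matrix.mulVec_mulVec, hlin]

theorem lintegral_gaussian_mean {d : ℕ} (m : Vec d) (C : Matrix (Fin d) (Fin d) ℝ)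
    {f : (Fin d → ℝ) → ENNReal} (hf : Measurable f) :
    ∫⁻ x, f x.ofLp ∂multivariateGaussian m C =
      ∫⁻ x, f (m.ofLp + x.ofLp) ∂multivariateGaussian (0 : Vec d) C := by
  rw [lintegral_multivariateGaussian m C hf,
    lintegral_multivariateGaussian 0 C (f := fun x => f (m.ofLp + x)) (by fun_prop)]
  simp

/-- Integral of a Gaussian likelihood with information matrix `G` and information vector `b` under
a Gaussian prior with mean `m` and covariance `C`. -/
theorem lintegral_gaussian_shift {d : ℕ} {C G : Matrix (Fin d) (Fin d) ℝ} (hC : C.PosDef)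
    (hG : G.PosSemidef) (m b : Fin d → ℝ) :
    ∫⁻ x, expE (b ⬝ᵥ (m + x.ofLp) - (m + x.ofLp) ⬝ᵥ G *ᵥ (m + x.ofLp) / 2)
        ∂multivariateGaussian (0 : Vec d) C =
      gaussConst C G * expE (b ⬝ᵥ (C⁻¹ + G)⁻¹ *ᵥ b / 2 + b ⬝ᵥ ((C⁻¹ + G)⁻¹ * C⁻¹) *ᵥ m
        - m ⬝ᵥ (C⁻¹ - C⁻¹ * (C⁻¹ + G)⁻¹ * C⁻¹) *ᵥ m / 2) := by
  have hT : (C⁻¹ + G).PosDef := hC.inv.add_posSemidef hG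
  set T := (C⁻¹ + G)⁻¹ with hTdef
  have hTT : T * (C⁻¹ + G) = 1 := posDef_inv_mul hT
  have hTT' : (C⁻¹ + G) * T = 1 := posDef_mul_inv hT
  have hTh : T.IsHermitian := hT.inv.1
  have hsplit : ∀ x : Vec d, expE (b ⬝ᵥ (m + x.ofLp) - (m + x.ofLp) ⬝ᵥ G *ᵥ (m + x.ofLp) / 2) =
      expE (b ⬝ᵥ m - m ⬝ᵥ G *ᵥ m / 2) *
        expE ((b - G *ᵥ m) ⬝ᵥ x.ofLp - x.ofLp ⬝ᵥ G *ᵥ x.ofLp / 2) := by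
    intro x
    rw [← expE_add]
    congr 1
    simp only [Matrix.mulVec_add, dotProduct_add, add_dotProduct, sub_dotProduct]
    rw [dotProduct_mulVec_symm hG.1 m x.ofLp, dotProduct_comm (G *ᵥ m) x.ofLp]
    ring
  simp_rw [hsplit]
  have hm : Measurable fun x : Vec d =>
      expE ((b - G *ᵥ m) ⬝ᵥ x.ofLp - x.ofLp ⬝ᵥ G *ᵥ x.ofLp / 2) :=
    measurable_expE_comp ((measurable_dotProduct measurable_const (by fun_prop)).sub
      (((measurable_quad G).comp (by fun_prop)).div_const 2))
  rw [lintegral_const_mul _ hm, lintegral_gaussian_quad hC hG, mul_left_comm, ← expE_add]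
  congr 2
  -- Since `T` inverts `C⁻¹ + G`, each product `T G` or `G T` can be traded for one with `C⁻¹`. The
  -- identity `e4` is the symmetry of the parallel sum of `C⁻¹` and `G`.
  have e1 : T * G = 1 - T * C⁻¹ := by rw [← hTT, Matrix.mul_add]; abel
  have e2 : T *ᵥ (G *ᵥ m) = m - (T * C⁻¹) *ᵥ m := by
    rw [Matrix.mulVec_mulVec, e1, Matrix.sub_mulVec, Matrix.one_mulVec]
  have e3 : G * T = 1 - C⁻¹ * T := by rw [← hTT', Matrix.add_mul]; abel
  have e4 : G - G * T * G = C⁻¹ - C⁻¹ * T * C⁻¹ := by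
    rw [e3, Matrix.sub_mul, Matrix.one_mul, Matrix.mul_assoc, e1, Matrix.mul_sub, Matrix.mul_one,
      Matrix.mul_assoc]
    abel
  rw [← e4, Matrix.mulVec_sub, Matrix.sub_mulVec, e2]
  simp only [dotProduct_sub, sub_dotProduct]
  have e5 : (G *ᵥ m) ⬝ᵥ T *ᵥ b = b ⬝ᵥ m - b ⬝ᵥ (T * C⁻¹) *ᵥ m := by
    rw [dotProduct_mulVec_symm hTh, e2, dotProduct_sub]
  have e6 : (G *ᵥ m) ⬝ᵥ (T * C⁻¹) *ᵥ m = m ⬝ᵥ (G * T * C⁻¹) *ᵥ m := by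
    rw [dotProduct_comm, dotProduct_mulVec_symm hG.1, Matrix.mulVec_mulVec, ← Matrix.mul_assoc]
  have e7 : G * T * G = G - G * T * C⁻¹ := by
    rw [Matrix.mul_assoc, e1, Matrix.mul_sub, Matrix.mul_one, Matrix.mul_assoc]
  rw [e5, e6, e7, Matrix.sub_mulVec, dotProduct_sub, dotProduct_comm (G *ᵥ m) m]
  ring

/-! ### Concentration from the moment generating function. -/

/-- The tilt turns the density of variance `1` into twice that of variance `4`, because `1/2 - 3/8 =
1/8`. The exponent `3/8` is chosen to make this value exactly `2`. -/
theorem lintegral_gaussianReal_exp_sq :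
    ∫⁻ x, expE (3 / 8 * (x * x)) ∂gaussianReal 0 1 = 2 := by
  rw [gaussianReal_of_var_ne_zero _ one_ne_zero,
    lintegral_withDensity_eq_lintegral_mul _ (measurable_gaussianPDF _ _)
      (measurable_expE_comp (by fun_prop))]
  have h : ∀ x : ℝ, (gaussianPDF 0 1 * fun x => expE (3 / 8 * (x * x))) x =
      2 * gaussianPDF 0 4 x := by
    intro x
    have h2 : (2 : ENNReal) = ENNReal.ofReal 2 := by simp
    simp only [Pi.mul_apply, gaussianPDF, gaussianPDFReal, expE]
    rw [h2, ← ENNReal.ofReal_mul (by positivity), ← ENNReal.ofReal_mul (by positivity), mul_assoc,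
      ← Real.exp_add]
    have h3 : √(2 * Real.pi * ((4 : NNReal) : ℝ)) = 2 * √(2 * Real.pi * ((1 : NNReal) : ℝ)) := by
      rw [show 2 * Real.pi * ((4 : NNReal) : ℝ) = 2 ^ 2 * (2 * Real.pi * ((1 : NNReal) : ℝ)) by
        push_cast; ring, Real.sqrt_mul (by norm_num), Real.sqrt_sq (by norm_num)]
    rw [h3, mul_inv, mul_assoc (2⁻¹ : ℝ), mul_inv_cancel_left₀ (two_ne_zero : (2 : ℝ) ≠ 0)]
    congr 3
    push_cast
    ring
  simp_rw [h]
  rw [lintegral_const_mul _ (measurable_gaussianPDF _ _),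
    lintegral_gaussianPDF_eq_one _ (by norm_num), mul_one]

theorem lintegral_stdPi_exp_sq (d : ℕ) :
    ∫⁻ x, expE (3 / 8 * (x ⬝ᵥ x)) ∂stdPi d = 2 ^ d := by
  have h : ∀ x : Fin d → ℝ, expE (3 / 8 * (x ⬝ᵥ x)) = ∏ i, expE (3 / 8 * (x i * x i)) := by
    intro x
    rw [← expE_sum, dotProduct, Finset.mul_sum]
  simp_rw [h]
  rw [stdPi, lintegral_pi_prod _ (fun _ y => expE (3 / 8 * (y * y)))
    fun _ => measurable_expE_comp (by fun_prop)]
  simp [lintegral_gaussianReal_exp_sq]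

section Concentration

variable {Ω : Type*} [MeasurableSpace Ω] {ν : Measure Ω} [IsProbabilityMeasure ν] {d : ℕ}

/-- Gaussian linearization: `exp (3/8 |z|²)` is the average of `exp (c x ⬝ z)` over a standard
Gaussian `x`, with `c² / 2 = 3/8`. After exchanging the integrals the hypothesis applies with `u = c
x`, so the law of `Z` need not be identified. -/
theorem lintegral_exp_sq_of_mgf {Z : Ω → Fin d → ℝ} (hZ : Measurable Z)
    (hmgf : ∀ u : Fin d → ℝ, ∫⁻ ω, expE (u ⬝ᵥ Z ω) ∂ν = expE (u ⬝ᵥ u / 2)) :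
    ∫⁻ ω, expE (3 / 8 * (Z ω ⬝ᵥ Z ω)) ∂ν = 2 ^ d := by
  have hc : √(3 / 4 : ℝ) * √(3 / 4) = 3 / 4 := Real.mul_self_sqrt (by norm_num)
  set c := √(3 / 4 : ℝ)
  have h1 : ∀ z : Fin d → ℝ, expE (3 / 8 * (z ⬝ᵥ z)) = ∫⁻ x, expE ((c • x) ⬝ᵥ z) ∂stdPi d := by
    intro z
    have h2 := lintegral_stdPi_exp (c • z)
    have h3 : ∀ x : Fin d → ℝ, (c • x) ⬝ᵥ z = (c • z) ⬝ᵥ x := fun x => by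
      rw [smul_dotProduct, smul_dotProduct, dotProduct_comm]
    simp_rw [h3, h2]
    rw [smul_dotProduct, dotProduct_smul, smul_eq_mul, smul_eq_mul, ← mul_assoc, hc]
    congr 1
    ring
  simp_rw [h1]
  rw [lintegral_lintegral_swap]
  · simp_rw [hmgf]
    rw [← lintegral_stdPi_exp_sq]
    refine lintegral_congr fun x => ?_
    rw [smul_dotProduct, dotProduct_smul, smul_eq_mul, smul_eq_mul, ← mul_assoc, hc]
    congr 1
    ring
  · refine (measurable_expE_comp (measurable_dotProduct ?_ ?_)).aemeasurable
    · exact measurable_snd.const_smul c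
    · exact hZ.comp measurable_fst

/-- Markov's inequality for `exp (3/8 |Z|²)` gives the tail `2 ^ d * exp (-15/8 d t)`, where `15/8 =
5 * 3/8`. For `d, t ≥ 1` this is at most `exp (-t)`, since `15/8 d t - t ≥ 7/8 d` and `log 2 < 7/8`.
-/
theorem chiSq_tail {Z : Ω → Fin d → ℝ} (hZ : Measurable Z)
    (hmgf : ∀ u : Fin d → ℝ, ∫⁻ ω, expE (u ⬝ᵥ Z ω) ∂ν = expE (u ⬝ᵥ u / 2))
    {t : ℝ} (ht : 1 ≤ t) :
    ENNReal.ofReal (1 - Real.exp (-t)) ≤ ν {ω | Z ω ⬝ᵥ Z ω ≤ 5 * d * t} := by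
  have hmZ : Measurable fun ω => Z ω ⬝ᵥ Z ω := measurable_dotProduct hZ hZ
  have hms : MeasurableSet {ω | Z ω ⬝ᵥ Z ω ≤ 5 * d * t} := measurableSet_le hmZ measurable_const
  have hcompl : ν {ω | Z ω ⬝ᵥ Z ω ≤ 5 * d * t}ᶜ ≤ ENNReal.ofReal (Real.exp (-t)) := by
    -- In dimension zero the Markov bound would only give `1`, but the complement is empty.
    rcases Nat.eq_zero_or_pos d with rfl | hd
    · simp [dotProduct]
    have hd' : (1 : ℝ) ≤ d := by exact_mod_cast hd
    have hmark := mul_meas_ge_le_lintegral (μ := ν)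
      (f := fun ω => expE (3 / 8 * (Z ω ⬝ᵥ Z ω)))
      (measurable_expE_comp (hmZ.const_mul _)) (expE (15 / 8 * d * t))
    rw [lintegral_exp_sq_of_mgf hZ hmgf] at hmark
    have hsub : ν {ω | Z ω ⬝ᵥ Z ω ≤ 5 * d * t}ᶜ ≤
        ν {ω | expE (15 / 8 * d * t) ≤ expE (3 / 8 * (Z ω ⬝ᵥ Z ω))} := by
      refine measure_mono fun ω hω => expE_mono ?_
      simp only [Set.mem_compl_iff, Set.mem_ofPred_eq, not_le] at hω
      linarith
    have hpow : (2 : ENNReal) ^ d = expE (d * Real.log 2) := by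
      rw [expE, ← Real.log_pow, Real.exp_log (by positivity),
        ENNReal.ofReal_pow (by norm_num)]
      simp
    have hexp : (2 : ENNReal) ^ d ≤ expE (15 / 8 * d * t) * expE (-t) := by
      rw [hpow, ← expE_add]
      refine expE_mono ?_
      have := Real.log_two_lt_d9
      nlinarith [mul_nonneg (sub_nonneg.2 hd') (sub_nonneg.2 ht)]
    have := hmark.trans hexp
    exact hsub.trans ((ENNReal.mul_le_mul_iff_right (expE_ne_zero _) (expE_ne_top _)).1 this)
  rw [ENNReal.ofReal_sub _ (Real.exp_pos _).le, ENNReal.ofReal_one, tsub_le_iff_right]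
  calc (1 : ENNReal) = ν {ω | Z ω ⬝ᵥ Z ω ≤ 5 * d * t} + ν {ω | Z ω ⬝ᵥ Z ω ≤ 5 * d * t}ᶜ := by
        rw [measure_add_measure_compl hms, measure_univ]
    _ ≤ _ := by gcongr

theorem sq_dotProduct_le {d : ℕ} (x y : Fin d → ℝ) : (x ⬝ᵥ y) ^ 2 ≤ (x ⬝ᵥ x) * (y ⬝ᵥ y) := by
  have := Finset.sum_mul_sq_le_sq_mul_sq Finset.univ x y
  simpa [dotProduct, sq] using this

/-- A random vector with Gaussian moment generating function lies, uniformly over directions,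
within `√(5 d t)` standard deviations of its mean with probability at least `1 - exp (-t)`. -/
theorem gaussian_concentration {Y : Ω → Fin d → ℝ} (hY : Measurable Y) {m : Fin d → ℝ}
    {V : Matrix (Fin d) (Fin d) ℝ} (hV : V.PosDef)
    (hmgf : ∀ u : Fin d → ℝ, ∫⁻ ω, expE (u ⬝ᵥ Y ω) ∂ν = expE (u ⬝ᵥ m + u ⬝ᵥ V *ᵥ u / 2))
    {t : ℝ} (ht : 1 ≤ t) :
    ENNReal.ofReal (1 - Real.exp (-t)) ≤
      ν {ω | ∀ v : Fin d → ℝ, |v ⬝ᵥ (Y ω - m)| ≤ √(5 * d * t) * √(v ⬝ᵥ V *ᵥ v)} := by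
  obtain ⟨R, hR, hRR⟩ : ∃ R : Matrix (Fin d) (Fin d) ℝ, R.IsHermitian ∧ R * R = V := by
    open scoped MatrixOrder in
    exact ⟨CFC.sqrt V, (Matrix.nonneg_iff_posSemidef.1 (CFC.sqrt_nonneg V)).1,
      CFC.sqrt_mul_sqrt_self _ hV.posSemidef.nonneg⟩
  have hRu : IsUnit R.det := by
    have h2 := (Matrix.isUnit_iff_isUnit_det _).1 hV.isUnit
    rw [← hRR, Matrix.det_mul] at h2
    exact isUnit_of_mul_isUnit_left h2
  have e1 : R * R⁻¹ = 1 := Matrix.mul_nonsing_inv R hRu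
  have e2 : R⁻¹ * R = 1 := Matrix.nonsing_inv_mul R hRu
  have hRi : (R⁻¹).IsHermitian := hR.inv
  -- `Z` is the whitened vector. A bound on its norm controls all directions simultaneously by
  -- Cauchy–Schwarz.
  set Z : Ω → Fin d → ℝ := fun ω => R⁻¹ *ᵥ (Y ω - m) with hZdef
  have hZ : Measurable Z := measurable_mulVec _ (hY.sub_const m)
  have hZm : ∀ u : Fin d → ℝ, ∫⁻ ω, expE (u ⬝ᵥ Z ω) ∂ν = expE (u ⬝ᵥ u / 2) := by
    intro u
    have h1 : ∀ ω, expE (u ⬝ᵥ Z ω) = expE (-((R⁻¹ *ᵥ u) ⬝ᵥ m)) * expE ((R⁻¹ *ᵥ u) ⬝ᵥ Y ω) := by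
      intro ω
      rw [← expE_add, hZdef]
      simp only
      rw [dotProduct_mulVec_symm hRi, dotProduct_comm, dotProduct_sub]
      congr 1
      ring
    simp_rw [h1]
    rw [lintegral_const_mul _ (measurable_expE_comp (measurable_dotProduct measurable_const hY)),
      hmgf, ← expE_add]
    congr 1
    have h2 : (R⁻¹ *ᵥ u) ⬝ᵥ V *ᵥ (R⁻¹ *ᵥ u) = u ⬝ᵥ u := by
      rw [← hRR, Matrix.mulVec_mulVec, Matrix.mul_assoc, e1, Matrix.mul_one, dotProduct_comm,
        dotProduct_mulVec_symm hRi, Matrix.mulVec_mulVec, e2, Matrix.one_mulVec]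
    rw [h2]
    ring
  refine (chiSq_tail hZ hZm ht).trans (measure_mono fun ω hω v => ?_)
  have h3 : v ⬝ᵥ (Y ω - m) = (R *ᵥ v) ⬝ᵥ Z ω := by
    rw [dotProduct_comm (R *ᵥ v), dotProduct_mulVec_symm hR, hZdef]
    simp only
    rw [Matrix.mulVec_mulVec, e1, Matrix.one_mulVec]
  have h4 : v ⬝ᵥ V *ᵥ v = (R *ᵥ v) ⬝ᵥ (R *ᵥ v) := by
    rw [dotProduct_mulVec_symm hR, Matrix.mulVec_mulVec, hRR]
  have h5 : 0 ≤ (R *ᵥ v) ⬝ᵥ (R *ᵥ v) := Finset.sum_nonneg fun i _ => mul_self_nonneg _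
  have h6 : 0 ≤ Z ω ⬝ᵥ Z ω := Finset.sum_nonneg fun i _ => mul_self_nonneg _
  rw [h3, h4, ← Real.sqrt_mul (h6.trans hω)]
  refine Real.abs_le_sqrt ((sq_dotProduct_le _ _).trans ?_)
  rw [mul_comm]
  exact mul_le_mul_of_nonneg_right hω h5

end Concentration

/-! ### The parallel sum of precision matrices. -/

section Info

variable {d : ℕ} {C G : Matrix (Fin d) (Fin d) ℝ}

/-- Information about the mean of a Gaussian prior with precision `C` that is carried by an
observation with information matrix `G`. It is the parallel sum of `C` and `G`. -/
def infoMat (C G : Matrix (Fin d) (Fin d) ℝ) : Matrix (Fin d) (Fin d) ℝ :=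
  C - C * (C + G)⁻¹ * C

/-- The parallel sum as an infimal convolution: with `y = (C + G)⁻¹ C x`, its quadratic form at `x`
is the `C`-form at `x - y` plus the `G`-form at `y`. Positivity and the lower bound
`infoMat_quad_ge` are read off from this. -/
theorem infoMat_eq (hC : C.PosDef) (hG : G.PosSemidef) :
    infoMat C G = (1 - (C + G)⁻¹ * C)ᴴ * C * (1 - (C + G)⁻¹ * C) +
      ((C + G)⁻¹ * C)ᴴ * G * ((C + G)⁻¹ * C) := by
  have hT : (C + G).PosDef := hC.add_posSemidef hG
  have hTT : (C + G) * (C + G)⁻¹ = 1 := posDef_mul_inv hT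
  have hTh : ((C + G)⁻¹)ᴴ = (C + G)⁻¹ := hT.inv.1
  have hCh : Cᴴ = C := hC.1
  rw [Matrix.conjTranspose_sub, Matrix.conjTranspose_mul, hTh, hCh, Matrix.conjTranspose_one,
    infoMat]
  have hGT : G * (C + G)⁻¹ = 1 - C * (C + G)⁻¹ := by rw [← hTT, Matrix.add_mul]; abel
  set T := (C + G)⁻¹
  have h : C * T * G * (T * C) = C * T * (G * T) * C := by simp only [Matrix.mul_assoc]
  rw [h, hGT]
  noncomm_ring

theorem infoMat_posSemidef (hC : C.PosDef) (hG : G.PosSemidef) : (infoMat C G).PosSemidef := by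
  rw [infoMat_eq hC hG]
  exact (hC.posSemidef.conjTranspose_mul_mul_same _).add (hG.conjTranspose_mul_mul_same _)

theorem inv_one_add_mul (hC : C.PosDef) : (1 + G * C)⁻¹ = C⁻¹ * (C⁻¹ + G)⁻¹ := by
  have h : C⁻¹ + G = (1 + G * C) * C⁻¹ := by
    rw [Matrix.add_mul, Matrix.one_mul, Matrix.mul_assoc, posDef_mul_inv hC, Matrix.mul_one]
  rw [h, Matrix.mul_inv_rev, ← Matrix.mul_assoc, Matrix.nonsing_inv_nonsing_inv _
    ((Matrix.isUnit_iff_isUnit_det _).1 hC.isUnit), posDef_inv_mul hC, Matrix.one_mul]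

/-- Identifies the information summand of `covHyper` with a parallel sum, without assuming `G`
invertible. -/
theorem inv_one_add_mul_mul (hC : C.PosDef) (hG : G.PosSemidef) :
    (1 + G * C)⁻¹ * G = infoMat C⁻¹ G := by
  have hTT : (C⁻¹ + G)⁻¹ * (C⁻¹ + G) = 1 := posDef_inv_mul (hC.inv.add_posSemidef hG)
  have hTG : (C⁻¹ + G)⁻¹ * G = 1 - (C⁻¹ + G)⁻¹ * C⁻¹ := by rw [← hTT, Matrix.mul_add]; abel
  rw [inv_one_add_mul hC, Matrix.mul_assoc, hTG, infoMat]
  noncomm_ring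

end Info

/-! ### The posterior law of a task parameter. -/

namespace Model

theorem lintegral_prior {d : ℕ} {S X A : Type*} [Fintype S] [MeasurableSpace X] (M : Model d X A)
    {f : Vec d × (S → Vec d) → ENNReal} (hf : Measurable f) :
    ∫⁻ p, f p ∂M.prior S = ∫⁻ μ, ∫⁻ q, f (μ, fun s => μ + q s)
      ∂(Measure.pi fun _ : S => multivariateGaussian (0 : Vec d) M.cov0)
      ∂multivariateGaussian M.muQ M.covQ := by
  rw [prior, lintegral_map hf (by fun_prop)]
  exact lintegral_prod (μ := multivariateGaussian M.muQ M.covQ)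
    (ν := Measure.pi fun _ : S => multivariateGaussian (0 : EuclideanSpace ℝ (Fin d)) M.cov0)
    (fun p => f (p.1, fun s => p.1 + p.2 s)) (hf.comp (by fun_prop)).aemeasurable

variable {d : ℕ} {S X A : Type*} [DecidableEq S] [MeasurableSpace X]
  (M : Model d X A) (D : Dataset S X A)

theorem reward_eq (x : X) (a : A) (θ : Vec d) : M.reward x a θ = (M.φ x a).ofLp ⬝ᵥ θ.ofLp := by
  rw [reward, EuclideanSpace.inner_eq_star_dotProduct, dotProduct_comm]
  simp

theorem vecMulVec_quad (v x : Fin d → ℝ) :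
    x ⬝ᵥ Matrix.vecMulVec v v *ᵥ x = (v ⬝ᵥ x) ^ 2 := by
  rw [Matrix.vecMulVec_mulVec, dotProduct_smul, dotProduct_comm x v]
  simp [sq]

theorem vecMulVec_posSemidef (v : Fin d → ℝ) : (Matrix.vecMulVec v v).PosSemidef := by
  simpa using Matrix.posSemidef_vecMulVec_self_star v

theorem gram_posSemidef (s : S) : (M.gram D s).PosSemidef := by
  refine Matrix.PosSemidef.smul (Matrix.posSemidef_sum _ fun t _ => ?_) (by positivity)
  split_ifs
  · exact vecMulVec_posSemidef _
  · exact Matrix.PosSemidef.zero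

theorem covTask_inv_posDef (hcov0 : M.cov0.PosDef) (s : S) :
    (M.cov0⁻¹ + M.gram D s).PosDef := hcov0.inv.add_posSemidef (M.gram_posSemidef D s)

theorem covTask_posDef (hcov0 : M.cov0.PosDef) (s : S) : (M.covTask D s).PosDef :=
  (M.covTask_inv_posDef D hcov0 s).inv

/-- Log-likelihood of the observations of one task, up to a constant. -/
theorem logLik_eq (s : S) (θ : Fin d → ℝ) :
    M.bvec D s ⬝ᵥ θ - θ ⬝ᵥ M.gram D s *ᵥ θ / 2 =
      ∑ t, if D.task t = s then (M.σ ^ 2)⁻¹ * (D.rew t * ((M.φ (D.ctx t) (D.act t)).ofLp ⬝ᵥ θ)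
        - ((M.φ (D.ctx t) (D.act t)).ofLp ⬝ᵥ θ) ^ 2 / 2) else 0 := by
  have h1 : M.bvec D s ⬝ᵥ θ = ∑ t, if D.task t = s then
      (M.σ ^ 2)⁻¹ * (D.rew t * ((M.φ (D.ctx t) (D.act t)).ofLp ⬝ᵥ θ)) else 0 := by
    rw [bvec, smul_dotProduct, sum_dotProduct, smul_eq_mul, Finset.mul_sum]
    refine Finset.sum_congr rfl fun t _ => ?_
    split_ifs
    · rw [smul_dotProduct, smul_eq_mul]
    · simp
  have h2 : θ ⬝ᵥ M.gram D s *ᵥ θ = ∑ t, if D.task t = s then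
      (M.σ ^ 2)⁻¹ * ((M.φ (D.ctx t) (D.act t)).ofLp ⬝ᵥ θ) ^ 2 else 0 := by
    rw [gram, Matrix.smul_mulVec, dotProduct_smul, Matrix.sum_mulVec, dotProduct_sum, smul_eq_mul,
      Finset.mul_sum]
    refine Finset.sum_congr rfl fun t _ => ?_
    split_ifs
    · rw [vecMulVec_quad]
    · simp
  rw [h1, h2, Finset.sum_div, ← Finset.sum_sub_distrib]
  refine Finset.sum_congr rfl fun t _ => ?_
  split_ifs
  · ring
  · simp

variable [Fintype S]

theorem covHyper_eq (hcov0 : M.cov0.PosDef) :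
    M.covHyper D = (M.covQ⁻¹ + ∑ z, infoMat M.cov0⁻¹ (M.gram D z))⁻¹ := by
  rw [covHyper]
  simp_rw [inv_one_add_mul_mul hcov0 (M.gram_posSemidef D _)]

theorem infoSum_posSemidef (hcov0 : M.cov0.PosDef) :
    (∑ z, infoMat M.cov0⁻¹ (M.gram D z)).PosSemidef :=
  Matrix.posSemidef_sum _ fun z _ => infoMat_posSemidef hcov0.inv (M.gram_posSemidef D z)

theorem covHyper_posDef (hcovQ : M.covQ.PosDef) (hcov0 : M.cov0.PosDef) :
    (M.covHyper D).PosDef := by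
  rw [covHyper_eq M D hcov0]
  exact (hcovQ.inv.add_posSemidef (M.infoSum_posSemidef D hcov0)).inv

theorem covPost_posDef (hcovQ : M.covQ.PosDef) (hcov0 : M.cov0.PosDef) (s : S) :
    (M.covPost D s).PosDef := by
  refine (M.covTask_posDef D hcov0 s).add_posSemidef ?_
  have h := (M.covHyper_posDef D hcovQ hcov0).posSemidef.conjTranspose_mul_mul_same
    (M.cov0⁻¹ * M.covTask D s)
  rw [Matrix.conjTranspose_mul, (M.covTask_posDef D hcov0 s).1, hcov0.inv.1] at h
  simpa only [Matrix.mul_assoc] using h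

theorem exists_likelihood_eq (hσ : 0 < M.σ) : ∃ K : ENNReal, K ≠ 0 ∧ K ≠ ⊤ ∧
    ∀ θ : S → Vec d, M.likelihood D θ = K * ∏ z,
      expE (M.bvec D z ⬝ᵥ (θ z).ofLp - (θ z).ofLp ⬝ᵥ M.gram D z *ᵥ (θ z).ofLp / 2) := by
  set v : NNReal := Real.toNNReal (M.σ ^ 2) with hv
  have hvr : (v : ℝ) = M.σ ^ 2 := Real.coe_toNNReal _ (by positivity)
  -- The constant is the likelihood at zero mean rewards; dividing by it leaves the part of the
  -- log-density that is linear and quadratic in the mean.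
  refine ⟨∏ t, gaussianPDF 0 v (D.rew t), ?_, ?_, fun θ => ?_⟩
  · refine Finset.prod_ne_zero_iff.2 fun t _ => ?_
    have : v ≠ 0 := by
      rw [← NNReal.coe_ne_zero, hvr]; positivity
    exact (gaussianPDF_pos 0 this _).ne'
  · exact ENNReal.prod_ne_top fun t _ => ENNReal.ofReal_ne_top
  · rw [← expE_sum]
    simp_rw [logLik_eq]
    rw [Finset.sum_comm]
    simp only [Finset.sum_ite_eq, Finset.mem_univ, if_true]
    rw [expE_sum, likelihood, ← Finset.prod_mul_distrib]
    refine Finset.prod_congr rfl fun t _ => ?_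
    rw [gaussianPDF, gaussianPDF, expE, ← ENNReal.ofReal_mul (gaussianPDFReal_nonneg _ _ _),
      gaussianPDFReal, gaussianPDFReal, mul_assoc _ (Real.exp _) (Real.exp _), ← Real.exp_add,
      reward_eq, ← hv, hvr]
    congr 3
    field_simp
    ring

theorem measurable_likelihood (hσ : 0 < M.σ) :
    Measurable fun θ : S → Vec d => M.likelihood D θ := by
  obtain ⟨K, -, -, h⟩ := M.exists_likelihood_eq D hσ
  simp_rw [h]
  refine (Finset.measurable_prod _ fun z _ => measurable_expE_comp ?_).const_mul K
  have hz : Measurable fun θ : S → Vec d => (θ z).ofLp := by fun_prop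
  exact (measurable_dotProduct measurable_const hz).sub
    (((measurable_quad _).comp hz).div_const 2)

/-- The linear functionals `w` only shift the information vectors `bvec`. Integrating out the task
parameters given `μ_*` leaves a quadratic exponential in `μ_*` with information matrix `J` and
vector `β`, and a second Gaussian integral finishes. The point is that `K` does not depend on `w`.
-/
theorem exists_lintegral_likelihood (hcovQ : M.covQ.PosDef) (hcov0 : M.cov0.PosDef)
    (hσ : 0 < M.σ) : ∃ K : ENNReal, K ≠ 0 ∧ K ≠ ⊤ ∧ ∀ w : S → Fin d → ℝ,
      ∫⁻ p, (∏ z, expE (w z ⬝ᵥ (p.2 z).ofLp)) * M.likelihood D p.2 ∂M.prior S = K *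
        expE (∑ z, (M.bvec D z + w z) ⬝ᵥ M.covTask D z *ᵥ (M.bvec D z + w z) / 2 +
          ((∑ z, (M.cov0⁻¹ * M.covTask D z) *ᵥ (M.bvec D z + w z)) ⬝ᵥ M.covHyper D *ᵥ
              (∑ z, (M.cov0⁻¹ * M.covTask D z) *ᵥ (M.bvec D z + w z)) / 2 +
            (∑ z, (M.cov0⁻¹ * M.covTask D z) *ᵥ (M.bvec D z + w z)) ⬝ᵥ
              (M.covHyper D * M.covQ⁻¹) *ᵥ M.muQ.ofLp)) := by
  obtain ⟨K, hK0, hKT, hK⟩ := M.exists_likelihood_eq D hσ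
  set J := ∑ z, infoMat M.cov0⁻¹ (M.gram D z) with hJ
  have hJp : J.PosSemidef := M.infoSum_posSemidef D hcov0
  have hH : M.covHyper D = (M.covQ⁻¹ + J)⁻¹ := M.covHyper_eq D hcov0
  set κ : ℝ := M.muQ.ofLp ⬝ᵥ (M.covQ⁻¹ - M.covQ⁻¹ * (M.covQ⁻¹ + J)⁻¹ * M.covQ⁻¹) *ᵥ
    M.muQ.ofLp / 2 with hκ
  refine ⟨K * (∏ z, gaussConst M.cov0 (M.gram D z)) * (gaussConst M.covQ J * expE (-κ)),
    ?_, ?_, fun w => ?_⟩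
  · exact mul_ne_zero (mul_ne_zero hK0 (Finset.prod_ne_zero_iff.2 fun z _ =>
      gaussConst_ne_zero _ _)) (mul_ne_zero (gaussConst_ne_zero _ _) (expE_ne_zero _))
  · exact ENNReal.mul_ne_top (ENNReal.mul_ne_top hKT (ENNReal.prod_ne_top fun z _ =>
      gaussConst_ne_top _ (M.gram_posSemidef D z)))
      (ENNReal.mul_ne_top (gaussConst_ne_top _ hJp) (expE_ne_top _))
  set b : S → Fin d → ℝ := fun z => M.bvec D z + w z with hb
  set β : Fin d → ℝ := ∑ z, (M.cov0⁻¹ * M.covTask D z) *ᵥ b z with hβ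
  let F : S → (Fin d → ℝ) → ENNReal := fun z x => expE (b z ⬝ᵥ x - x ⬝ᵥ M.gram D z *ᵥ x / 2)
  have hF : ∀ z, Measurable (F z) := fun z => measurable_expE_comp
    ((measurable_dotProduct measurable_const measurable_id).sub ((measurable_quad _).div_const 2))
  have h1 : ∀ p : Vec d × (S → Vec d), (∏ z, expE (w z ⬝ᵥ (p.2 z).ofLp)) * M.likelihood D p.2 =
      K * ∏ z, F z (p.2 z).ofLp := by
    intro p
    rw [hK, mul_left_comm, ← Finset.prod_mul_distrib]
    congr 1
    refine Finset.prod_congr rfl fun z _ => ?_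
    rw [← expE_add]
    simp only [F, hb, add_dotProduct]
    congr 1
    ring
  simp_rw [h1]
  have hFm : Measurable fun p : Vec d × (S → Vec d) => ∏ z, F z (p.2 z).ofLp :=
    Finset.measurable_prod _ fun z _ => (hF z).comp (by fun_prop)
  rw [lintegral_const_mul _ hFm, lintegral_prior M hFm]
  have h2 : ∀ μ : Vec d, ∫⁻ q : S → Vec d, ∏ z, F z (μ + q z).ofLp
        ∂(Measure.pi fun _ : S => multivariateGaussian (0 : Vec d) M.cov0) =
      (∏ z, gaussConst M.cov0 (M.gram D z)) * (expE (∑ z, b z ⬝ᵥ M.covTask D z *ᵥ b z / 2) *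
        expE (β ⬝ᵥ μ.ofLp - μ.ofLp ⬝ᵥ J *ᵥ μ.ofLp / 2)) := by
    intro μ
    rw [lintegral_pi_prod (fun _ : S => multivariateGaussian (0 : Vec d) M.cov0)
      (fun z x => F z (μ + x).ofLp) fun z => (hF z).comp (by fun_prop)]
    have h3 := fun z => lintegral_gaussian_shift hcov0 (M.gram_posSemidef D z) μ.ofLp (b z)
    have h4 : ∀ z, ∫⁻ x, F z (μ + x).ofLp ∂multivariateGaussian (0 : Vec d) M.cov0 = _ := h3
    simp_rw [h4]
    rw [Finset.prod_mul_distrib, ← expE_sum, ← expE_add]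
    congr 2
    have h5 : β ⬝ᵥ μ.ofLp = ∑ z, b z ⬝ᵥ ((M.cov0⁻¹ + M.gram D z)⁻¹ * M.cov0⁻¹) *ᵥ μ.ofLp := by
      rw [hβ, sum_dotProduct]
      refine Finset.sum_congr rfl fun z _ => ?_
      exact mul_mulVec_dotProduct_symm hcov0.inv.1 (M.covTask_posDef D hcov0 z).1 _ _
    have h6 : μ.ofLp ⬝ᵥ J *ᵥ μ.ofLp = ∑ z, μ.ofLp ⬝ᵥ (M.cov0⁻¹ - M.cov0⁻¹ *
        (M.cov0⁻¹ + M.gram D z)⁻¹ * M.cov0⁻¹) *ᵥ μ.ofLp := by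
      rw [hJ, Matrix.sum_mulVec, dotProduct_sum]
      rfl
    rw [h5, h6, Finset.sum_div, Finset.sum_sub_distrib, Finset.sum_add_distrib, add_sub_assoc]
    rfl
  simp_rw [h2]
  have hm2 : Measurable fun x : Fin d → ℝ => expE (β ⬝ᵥ x - x ⬝ᵥ J *ᵥ x / 2) :=
    measurable_expE_comp ((measurable_dotProduct measurable_const measurable_id).sub
      ((measurable_quad _).div_const 2))
  have hm3 : Measurable fun x : Vec d => expE (β ⬝ᵥ x.ofLp - x.ofLp ⬝ᵥ J *ᵥ x.ofLp / 2) :=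
    hm2.comp (by fun_prop)
  rw [lintegral_const_mul _ (hm3.const_mul _), lintegral_const_mul _ hm3,
    lintegral_gaussian_mean M.muQ M.covQ hm2, lintegral_gaussian_shift hcovQ hJp, ← hH, hκ, ← hH,
    sub_eq_add_neg, expE_add, expE_add (∑ z, _)]
  ring

theorem sum_single_split (u : Fin d → ℝ) (s : S) (f : S → (Fin d → ℝ) → ℝ) (b : S → Fin d → ℝ) :
    ∑ z, f z (b z + Pi.single (M := fun _ => Fin d → ℝ) s u z) =
      ∑ z, f z (b z) + (f s (b s + u) - f s (b s)) := by
  rw [← sub_eq_iff_eq_add', ← Finset.sum_sub_distrib, Finset.sum_eq_single s]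
  · simp
  · intro z _ hz
    simp [Pi.single_eq_of_ne hz]
  · simp

theorem exists_lintegral_mgf (hcovQ : M.covQ.PosDef) (hcov0 : M.cov0.PosDef)
    (hσ : 0 < M.σ) (s : S) : ∃ K : ENNReal, K ≠ 0 ∧ K ≠ ⊤ ∧ ∀ u : Fin d → ℝ,
      ∫⁻ p, expE (u ⬝ᵥ (p.2 s).ofLp) * M.likelihood D p.2 ∂M.prior S =
        K * expE (u ⬝ᵥ M.meanPost D s + u ⬝ᵥ M.covPost D s *ᵥ u / 2) := by
  obtain ⟨K, hK0, hKT, hK⟩ := M.exists_lintegral_likelihood D hcovQ hcov0 hσ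
  set T := M.covTask D with hT
  set C := M.cov0⁻¹ with hC
  set H := M.covHyper D with hH
  set b := M.bvec D with hb
  set β := ∑ z, (C * T z) *ᵥ b z with hβ
  set E : ℝ := ∑ z, b z ⬝ᵥ T z *ᵥ b z / 2 +
    (β ⬝ᵥ H *ᵥ β / 2 + β ⬝ᵥ (H * M.covQ⁻¹) *ᵥ M.muQ.ofLp) with hE
  have hTh : ∀ z, (T z).IsHermitian := fun z => (M.covTask_posDef D hcov0 z).1
  have hCh : C.IsHermitian := hcov0.inv.1
  have hHh : H.IsHermitian := (M.covHyper_posDef D hcovQ hcov0).1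
  refine ⟨K * expE E, mul_ne_zero hK0 (expE_ne_zero _), ENNReal.mul_ne_top hKT (expE_ne_top _),
    fun u => ?_⟩
  -- Only task `s` is tilted. In the resulting exponent the terms linear in `u` form the posterior
  -- mean, the quadratic ones the posterior covariance, and the rest is absorbed in the constant.
  have h0 := hK (Pi.single (M := fun _ => Fin d → ℝ) s u)
  have h1 : ∀ p : Vec d × (S → Vec d),
      ∏ z, expE (Pi.single (M := fun _ => Fin d → ℝ) s u z ⬝ᵥ (p.2 z).ofLp) =
        expE (u ⬝ᵥ (p.2 s).ofLp) := by
    intro p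
    rw [Finset.prod_eq_single s]
    · simp
    · intro z _ hz
      simp [Pi.single_eq_of_ne hz, expE_zero]
    · simp
  simp_rw [h1] at h0
  rw [h0, mul_assoc, ← expE_add]
  congr 2
  have h2 : ∑ z, (C * T z) *ᵥ (b z + Pi.single (M := fun _ => Fin d → ℝ) s u z) =
      β + (C * T s) *ᵥ u := by
    simp_rw [Matrix.mulVec_add, Finset.sum_add_distrib]
    congr 1
    rw [Finset.sum_eq_single s]
    · simp
    · intro z _ hz
      simp [Pi.single_eq_of_ne hz]
    · simp
  rw [h2, sum_single_split u s (fun z x => x ⬝ᵥ T z *ᵥ x / 2) b, hE]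
  have hmean : M.meanHyper D = H *ᵥ (M.covQ⁻¹ *ᵥ M.muQ.ofLp + β) := by
    rw [meanHyper, hβ]
    simp_rw [inv_one_add_mul hcov0]
    rfl
  have hpm : u ⬝ᵥ M.meanPost D s = u ⬝ᵥ T s *ᵥ b s +
      ((C * T s) *ᵥ u) ⬝ᵥ (H * M.covQ⁻¹) *ᵥ M.muQ.ofLp + ((C * T s) *ᵥ u) ⬝ᵥ H *ᵥ β := by
    rw [meanPost, hmean, mul_mulVec_dotProduct_symm hCh (hTh s),
      mul_mulVec_dotProduct_symm hCh (hTh s)]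
    simp only [Matrix.mulVec_add, dotProduct_add, Matrix.mulVec_mulVec, Matrix.mul_assoc]
    ring
  have hpc : u ⬝ᵥ M.covPost D s *ᵥ u = u ⬝ᵥ T s *ᵥ u +
      ((C * T s) *ᵥ u) ⬝ᵥ H *ᵥ ((C * T s) *ᵥ u) := by
    rw [covPost, mul_mulVec_dotProduct_symm hCh (hTh s), Matrix.add_mulVec, dotProduct_add]
    simp only [Matrix.mulVec_mulVec, Matrix.mul_assoc, hT, hC, hH]
  rw [hpm, hpc]
  simp only [Matrix.mulVec_add, dotProduct_add, add_dotProduct]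
  rw [dotProduct_mulVec_symm (hTh s) (b s) u, dotProduct_mulVec_symm hHh β ((C * T s) *ᵥ u)]
  ring

theorem lintegral_posterior (hσ : 0 < M.σ) {f : Vec d × (S → Vec d) → ENNReal}
    (hf : Measurable f) :
    ∫⁻ p, f p ∂M.posterior D = (∫⁻ p, M.likelihood D p.2 ∂M.prior S)⁻¹ *
      ∫⁻ p, f p * M.likelihood D p.2 ∂M.prior S := by
  have hL : Measurable fun p : Vec d × (S → Vec d) => M.likelihood D p.2 :=
    (M.measurable_likelihood D hσ).comp measurable_snd
  rw [posterior, lintegral_smul_measure, lintegral_withDensity_eq_lintegral_mul _ hL hf,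
    smul_eq_mul]
  congr 1
  refine lintegral_congr fun p => mul_comm _ _

/-- Under the posterior, the parameter of task `s` is Gaussian with mean `meanPost` and covariance
`covPost`, in terms of its moment generating function. -/
theorem lintegral_posterior_mgf (hcovQ : M.covQ.PosDef) (hcov0 : M.cov0.PosDef)
    (hσ : 0 < M.σ) (s : S) (u : Fin d → ℝ) :
    ∫⁻ p, expE (u ⬝ᵥ (p.2 s).ofLp) ∂M.posterior D =
      expE (u ⬝ᵥ M.meanPost D s + u ⬝ᵥ M.covPost D s *ᵥ u / 2) := by
  obtain ⟨K, hK0, hKT, hK⟩ := M.exists_lintegral_mgf D hcovQ hcov0 hσ s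
  have hm : Measurable fun p : Vec d × (S → Vec d) => (p.2 s).ofLp := by fun_prop
  -- Taking `u = 0` shows that `K` is the normalizing constant of the posterior, so it cancels.
  have h0 := hK 0
  simp only [zero_dotProduct, expE_zero, one_mul, zero_div, add_zero, mul_one] at h0
  rw [M.lintegral_posterior D hσ (measurable_expE_comp (measurable_dotProduct measurable_const hm)),
    hK, h0, ← mul_assoc, ENNReal.inv_mul_cancel hK0 hKT, one_mul]

theorem isProbabilityMeasure_posterior (hcovQ : M.covQ.PosDef) (hcov0 : M.cov0.PosDef)
    (hσ : 0 < M.σ) (s : S) : IsProbabilityMeasure (M.posterior D) := by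
  constructor
  have := M.lintegral_posterior_mgf D hcovQ hcov0 hσ s 0
  simpa [expE_zero] using this

theorem posterior_concentration (hcovQ : M.covQ.PosDef) (hcov0 : M.cov0.PosDef)
    (hσ : 0 < M.σ) (s : S) {t : ℝ} (ht : 1 ≤ t) :
    ENNReal.ofReal (1 - Real.exp (-t)) ≤ M.posterior D {p | ∀ v : Fin d → ℝ,
      |v ⬝ᵥ ((p.2 s).ofLp - M.meanPost D s)| ≤
        √(5 * d * t) * √(v ⬝ᵥ M.covPost D s *ᵥ v)} := by
  have := M.isProbabilityMeasure_posterior D hcovQ hcov0 hσ s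
  exact gaussian_concentration (Y := fun p : Vec d × (S → Vec d) => (p.2 s).ofLp) (by fun_prop)
    (M.covPost_posDef D hcovQ hcov0 s) (M.lintegral_posterior_mgf D hcovQ hcov0 hσ s) ht

end Model

/-! ### Comparison of quadratic forms, and the Woodbury identity. -/

section Loewner

variable {d : ℕ} {A B C G P : Matrix (Fin d) (Fin d) ℝ}

theorem sum_mul_self_nonneg (x : Fin d → ℝ) : 0 ≤ x ⬝ᵥ x :=
  Finset.sum_nonneg fun _ _ => mul_self_nonneg _

theorem posSemidef_of_quad_le (hA : A.IsHermitian) (hB : B.IsHermitian)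
    (h : ∀ x, x ⬝ᵥ A *ᵥ x ≤ x ⬝ᵥ B *ᵥ x) : (B - A).PosSemidef := by
  refine Matrix.PosSemidef.of_dotProduct_mulVec_nonneg (hB.sub hA) fun x => ?_
  rw [star_trivial, Matrix.sub_mulVec, dotProduct_sub]
  exact sub_nonneg.2 (h x)

theorem quad_le_of_posSemidef (h : (B - A).PosSemidef) (x : Fin d → ℝ) :
    x ⬝ᵥ A *ᵥ x ≤ x ⬝ᵥ B *ᵥ x := by
  have := posSemidef_quad_nonneg h x
  rw [Matrix.sub_mulVec, dotProduct_sub] at this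
  linarith

/-- The form of `A` is nonnegative at `A⁻¹ x - y`. Choosing `y` proportional to `x` turns an upper
bound on `A` into a lower bound on `A⁻¹`. -/
theorem two_mul_dotProduct_sub_quad_le (hA : A.PosDef) (x y : Fin d → ℝ) :
    2 * (x ⬝ᵥ y) - y ⬝ᵥ A *ᵥ y ≤ x ⬝ᵥ A⁻¹ *ᵥ x := by
  have h := posSemidef_quad_nonneg hA.posSemidef (A⁻¹ *ᵥ x - y)
  have h1 : A *ᵥ (A⁻¹ *ᵥ x) = x := by
    rw [Matrix.mulVec_mulVec, posDef_mul_inv hA, Matrix.one_mulVec]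
  rw [Matrix.mulVec_sub, h1] at h
  simp only [sub_dotProduct, dotProduct_sub] at h
  have h2 : (A⁻¹ *ᵥ x) ⬝ᵥ A *ᵥ y = x ⬝ᵥ y := by
    rw [dotProduct_mulVec_symm hA.1, h1, dotProduct_comm]
  rw [h2, dotProduct_comm _ x, dotProduct_comm y x] at h
  linarith

theorem inv_smul_le_quad_inv (hA : A.PosDef) {k : ℝ} (hk : 0 < k)
    (h : ∀ y, y ⬝ᵥ A *ᵥ y ≤ k * (y ⬝ᵥ y)) (x : Fin d → ℝ) :
    k⁻¹ * (x ⬝ᵥ x) ≤ x ⬝ᵥ A⁻¹ *ᵥ x := by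
  have h1 := two_mul_dotProduct_sub_quad_le hA x (k⁻¹ • x)
  have h2 := h (k⁻¹ • x)
  simp only [dotProduct_smul, smul_dotProduct, smul_eq_mul] at h1 h2
  have h3 : k * (k⁻¹ * (k⁻¹ * (x ⬝ᵥ x))) = k⁻¹ * (x ⬝ᵥ x) := by field_simp
  linarith

/-- The parallel sum of `C ≥ κ` and `G ≥ g` is at least the parallel sum of `κ` and `g`. -/
theorem infoMat_quad_ge (hC : C.PosDef) (hG : G.PosSemidef) {κ g : ℝ} (hκ : 0 < κ) (hg : 0 < g)
    (hCκ : ∀ y, κ * (y ⬝ᵥ y) ≤ y ⬝ᵥ C *ᵥ y) (hGg : ∀ y, g * (y ⬝ᵥ y) ≤ y ⬝ᵥ G *ᵥ y)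
    (x : Fin d → ℝ) : κ * g / (κ + g) * (x ⬝ᵥ x) ≤ x ⬝ᵥ infoMat C G *ᵥ x := by
  set L := (C + G)⁻¹ * C with hL
  set y := L *ᵥ x with hy
  have hconj : ∀ N B : Matrix (Fin d) (Fin d) ℝ,
      x ⬝ᵥ (Nᴴ * B * N) *ᵥ x = (N *ᵥ x) ⬝ᵥ B *ᵥ (N *ᵥ x) := by
    intro N B
    rw [Matrix.conjTranspose_eq_transpose_of_trivial, ← Matrix.mulVec_mulVec,
      ← Matrix.mulVec_mulVec, Matrix.dotProduct_mulVec x, Matrix.vecMul_transpose]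
  have h1 : x ⬝ᵥ infoMat C G *ᵥ x = (x - y) ⬝ᵥ C *ᵥ (x - y) + y ⬝ᵥ G *ᵥ y := by
    rw [infoMat_eq hC hG, Matrix.add_mulVec, dotProduct_add, hconj, hconj, Matrix.sub_mulVec,
      Matrix.one_mulVec]
  have h2 := hCκ (x - y)
  have h3 := hGg y
  -- The difference of the two sides of `h5` is exactly the squared norm of `κ (x - y) - g y`.
  have h4 := sum_mul_self_nonneg (κ • (x - y) - g • y)
  have h5 : κ * g * (x ⬝ᵥ x) ≤ (κ + g) * (κ * ((x - y) ⬝ᵥ (x - y)) + g * (y ⬝ᵥ y)) := by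
    simp only [dotProduct_smul, smul_dotProduct, smul_eq_mul, dotProduct_sub, sub_dotProduct,
      dotProduct_comm y x] at h4 ⊢
    nlinarith
  rw [h1, div_mul_eq_mul_div, div_le_iff₀ (by positivity)]
  nlinarith

/-- The Woodbury identity behind the hierarchical posterior covariance. -/
theorem woodbury_posterior (hP : P.PosDef) (hC : C.PosDef) (hG : G.PosSemidef) :
    (C + G)⁻¹ + (C + G)⁻¹ * C * (P + infoMat C G)⁻¹ * C * (C + G)⁻¹ = (infoMat C P + G)⁻¹ := by
  symm
  apply Matrix.inv_eq_left_inv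
  have hT : (C + G)⁻¹ * (C + G) = 1 := posDef_inv_mul (hC.add_posSemidef hG)
  have hR : (C + P) * (C + P)⁻¹ = 1 := posDef_mul_inv (hC.add hP)
  have hH : (P + infoMat C G)⁻¹ * (P + infoMat C G) = 1 :=
    posDef_inv_mul (hP.add_posSemidef (infoMat_posSemidef hC hG))
  have hN : infoMat C P + G = (C + G) - C * (C + P)⁻¹ * C := by rw [infoMat]; abel
  have hK : C * (C + G)⁻¹ * C = (C + P) - (P + infoMat C G) := by rw [infoMat]; abel
  rw [hN]
  set T := (C + G)⁻¹
  set R := (C + P)⁻¹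
  set H := (P + infoMat C G)⁻¹
  -- A resolvent identity: `C T C` is the difference of the matrices inverted by `R` and `H`.
  have h1 : H * (C * T * C) * R = H - R := by
    rw [hK, Matrix.mul_sub, hH, Matrix.sub_mul, Matrix.mul_assoc, hR, Matrix.mul_one,
      Matrix.one_mul]
  calc (T + T * C * H * C * T) * ((C + G) - C * R * C)
      = T * (C + G) + T * C * H * C * (T * (C + G)) - T * C * R * C
        - T * C * (H * (C * T * C) * R) * C := by noncomm_ring
    _ = 1 := by rw [h1, hT]; noncomm_ring

/-- Conjugating `v N - G ≥ 0` by `√(N⁻¹)` and taking traces gives `v d - tr (N⁻¹ G) ≥ 0`. -/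
theorem trace_inv_mul_le {N : Matrix (Fin d) (Fin d) ℝ} (hN : N.PosDef) (hG : G.IsHermitian)
    {v : ℝ} (h : ∀ x, x ⬝ᵥ G *ᵥ x ≤ v * (x ⬝ᵥ N *ᵥ x)) : (N⁻¹ * G).trace ≤ v * d := by
  obtain ⟨R, hR, hRR⟩ : ∃ R : Matrix (Fin d) (Fin d) ℝ, R.IsHermitian ∧ R * R = N⁻¹ := by
    open scoped MatrixOrder in
    exact ⟨CFC.sqrt N⁻¹, (Matrix.nonneg_iff_posSemidef.1 (CFC.sqrt_nonneg N⁻¹)).1,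
      CFC.sqrt_mul_sqrt_self _ hN.inv.posSemidef.nonneg⟩
  have h1 : (v • N - G).PosSemidef := by
    refine posSemidef_of_quad_le hG (hN.1.smul (IsSelfAdjoint.all v)) fun x => ?_
    rw [Matrix.smul_mulVec, dotProduct_smul, smul_eq_mul]
    exact h x
  have h2 := (h1.conjTranspose_mul_mul_same R).trace_nonneg
  rw [hR, Matrix.trace_mul_comm, ← Matrix.mul_assoc, hRR, Matrix.mul_sub, Matrix.mul_smul,
    posDef_inv_mul hN, Matrix.trace_sub, Matrix.trace_smul, Matrix.trace_one] at h2
  simpa using h2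

end Loewner

/-! ### Extreme eigenvalues as bounds on quadratic forms. -/

section Eigenvalues

variable {d : ℕ} {A : Matrix (Fin d) (Fin d) ℝ}

theorem quad_smul_one (k : ℝ) (x : Fin d → ℝ) :
    x ⬝ᵥ (algebraMap ℝ (Matrix (Fin d) (Fin d) ℝ) k) *ᵥ x = k * (x ⬝ᵥ x) := by
  rw [Algebra.algebraMap_eq_smul_one, Matrix.smul_mulVec, Matrix.one_mulVec, dotProduct_smul,
    smul_eq_mul]

theorem isHermitian_algebraMap (k : ℝ) :
    (algebraMap ℝ (Matrix (Fin d) (Fin d) ℝ) k).IsHermitian := by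
  rw [Algebra.algebraMap_eq_smul_one]
  exact Matrix.isHermitian_one.smul (IsSelfAdjoint.all k)

theorem forall_spectrum_ge_iff (hA : A.IsHermitian) (k : ℝ) :
    (∀ x, k * (x ⬝ᵥ x) ≤ x ⬝ᵥ A *ᵥ x) ↔ ∀ l ∈ spectrum ℝ A, k ≤ l := by
  have h1 : (∀ x, k * (x ⬝ᵥ x) ≤ x ⬝ᵥ A *ᵥ x) ↔ (A - algebraMap ℝ _ k).PosSemidef := by
    constructor
    · intro h
      exact posSemidef_of_quad_le (isHermitian_algebraMap k) hA fun x => by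
        rw [quad_smul_one]; exact h x
    · intro h x
      rw [← quad_smul_one]
      exact quad_le_of_posSemidef h x
  rw [h1, Matrix.posSemidef_iff_isHermitian_and_spectrum_nonneg, ← spectrum.sub_singleton_eq]
  constructor
  · rintro ⟨-, h⟩ l hl
    have := h (Set.sub_mem_sub hl (Set.mem_singleton k))
    simpa using this
  · intro h
    refine ⟨hA.sub (isHermitian_algebraMap k), ?_⟩
    rintro _ ⟨l, hl, _, rfl, rfl⟩
    simpa using h l hl

/-- This direction holds in every dimension; positivity and `le_lamMin` need `0 < d`, since the
infimum of the empty spectrum is `0` by convention. -/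
theorem lamMin_mul_le (hA : A.IsHermitian) (x : Fin d → ℝ) :
    lamMin A * (x ⬝ᵥ x) ≤ x ⬝ᵥ A *ᵥ x :=
  (forall_spectrum_ge_iff hA _).2 (fun _ hl => csInf_le A.finite_real_spectrum.bddBelow hl) x

theorem le_lamMax_mul (hA : A.IsHermitian) (x : Fin d → ℝ) :
    x ⬝ᵥ A *ᵥ x ≤ lamMax A * (x ⬝ᵥ x) := by
  have h := (forall_spectrum_ge_iff hA.neg (-lamMax A)).2 (fun l hl => by
    rw [← spectrum.neg_eq, Set.mem_neg] at hl
    have := le_csSup A.finite_real_spectrum.bddAbove hl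
    change -l ≤ lamMax A at this
    linarith) x
  rw [Matrix.neg_mulVec, dotProduct_neg] at h
  linarith

theorem spectrum_nonempty (hd : 0 < d) (hA : A.IsHermitian) : (spectrum ℝ A).Nonempty :=
  ⟨_, hA.eigenvalues_mem_spectrum_real ⟨0, hd⟩⟩

theorem le_lamMin (hd : 0 < d) (hA : A.IsHermitian) {k : ℝ}
    (h : ∀ x, k * (x ⬝ᵥ x) ≤ x ⬝ᵥ A *ᵥ x) : k ≤ lamMin A :=
  le_csInf (spectrum_nonempty hd hA) ((forall_spectrum_ge_iff hA k).1 h)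

theorem lamMin_pos (hd : 0 < d) (hA : A.PosDef) : 0 < lamMin A := by
  have h : lamMin A ∈ spectrum ℝ A :=
    (spectrum_nonempty hd hA.1).csInf_mem A.finite_real_spectrum
  rw [hA.1.spectrum_real_eq_range_eigenvalues] at h
  obtain ⟨i, hi⟩ := h
  rw [← hi]
  exact hA.eigenvalues_pos i

theorem lamMax_pos (hd : 0 < d) (hA : A.PosDef) : 0 < lamMax A := by
  have h := hA.1.eigenvalues_mem_spectrum_real ⟨0, hd⟩
  exact (hA.eigenvalues_pos ⟨0, hd⟩).trans_le (le_csSup A.finite_real_spectrum.bddAbove h)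

theorem inv_lamMax_mul_le_quad_inv (hd : 0 < d) (hA : A.PosDef) (x : Fin d → ℝ) :
    (lamMax A)⁻¹ * (x ⬝ᵥ x) ≤ x ⬝ᵥ A⁻¹ *ᵥ x :=
  inv_smul_le_quad_inv hA (lamMax_pos hd hA) (le_lamMax_mul hA.1) x

theorem inv_lamMax_le_lamMin_inv (hd : 0 < d) (hA : A.PosDef) : (lamMax A)⁻¹ ≤ lamMin A⁻¹ :=
  le_lamMin hd hA.inv.1 (inv_lamMax_mul_le_quad_inv hd hA)

end Eigenvalues

/-! ### Jensen's inequality, feature moments and the cost of pessimism. -/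

theorem integral_sqrt_le_sqrt_integral {Ω : Type*} [MeasurableSpace Ω] (ν : Measure Ω)
    [IsProbabilityMeasure ν] {q : Ω → ℝ} (hq : Integrable q ν) (h0 : ∀ ω, 0 ≤ q ω) :
    Integrable (fun ω => √(q ω)) ν ∧ ∫ ω, √(q ω) ∂ν ≤ √(∫ ω, q ω ∂ν) := by
  have hi : Integrable (fun ω => √(q ω)) ν := by
    refine Integrable.mono' ((integrable_const (1 : ℝ)).add hq)
      (Real.continuous_sqrt.comp_aestronglyMeasurable hq.1) (Filter.Eventually.of_forall fun ω => ?_)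
    rw [Real.norm_of_nonneg (Real.sqrt_nonneg _), Pi.add_apply]
    nlinarith [Real.sq_sqrt (h0 ω), sq_nonneg (√(q ω) - 1), Real.sqrt_nonneg (q ω)]
  refine ⟨hi, Real.le_sqrt_of_sq_le ?_⟩
  set c := ∫ ω, √(q ω) ∂ν with hc
  -- Jensen for the square root is nonnegativity of the variance of `√q`.
  have h1 : 0 ≤ ∫ ω, (q ω - 2 * c * √(q ω) + c ^ 2) ∂ν := by
    refine integral_nonneg fun ω => ?_
    have := Real.sq_sqrt (h0 ω)
    simp only [Pi.zero_apply]
    nlinarith [sq_nonneg (√(q ω) - c)]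
  have h2 : Integrable (fun ω => q ω - 2 * c * √(q ω)) ν := hq.sub (hi.const_mul _)
  rw [integral_add h2 (integrable_const _), integral_sub hq (hi.const_mul _),
    integral_const_mul, ← hc, integral_const, probReal_univ, one_smul] at h1
  nlinarith

namespace Model

section Features

variable {d : ℕ} {X A : Type*} [MeasurableSpace X] {M : Model d X A}

theorem feature_dotProduct_self_le (hbdd : ∀ x a, ‖M.φ x a‖ ≤ 1) (x : X) (a : A) :
    (M.φ x a).ofLp ⬝ᵥ (M.φ x a).ofLp ≤ 1 := by
  have h : (M.φ x a).ofLp ⬝ᵥ (M.φ x a).ofLp = ‖M.φ x a‖ ^ 2 := by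
    rw [EuclideanSpace.real_norm_sq_eq]
    simp [dotProduct, sq]
  rw [h]
  exact pow_le_one₀ (norm_nonneg _) (hbdd x a)

theorem abs_feature_le (hbdd : ∀ x a, ‖M.φ x a‖ ≤ 1) (x : X) (a : A) (i : Fin d) :
    |M.φ x a i| ≤ 1 := by
  have := PiLp.norm_apply_le (M.φ x a) i
  rw [Real.norm_eq_abs] at this
  exact this.trans (hbdd x a)

theorem popGram_isHermitian (π : X → A) : (M.popGram π).IsHermitian := by
  ext i j
  simp only [Matrix.conjTranspose_apply, popGram, Matrix.of_apply, star_trivial]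
  simp_rw [mul_comm]

variable [Finite A] [MeasurableSpace A] [MeasurableSingletonClass A]

theorem measurable_feature (hφ : ∀ a, Measurable fun x => M.φ x a) {π : X → A}
    (hπ : Measurable π) : Measurable fun x => (M.φ x (π x)).ofLp := by
  have h : Measurable fun p : X × A => M.φ p.1 p.2 := measurable_from_prod_countable_left hφ
  have h2 : Measurable fun x => M.φ x (π x) := h.comp (measurable_id.prodMk hπ)
  fun_prop

variable [IsProbabilityMeasure M.Px]

theorem integrable_feature (hφ : ∀ a, Measurable fun x => M.φ x a)
    (hbdd : ∀ x a, ‖M.φ x a‖ ≤ 1) {π : X → A} (hπ : Measurable π) (i : Fin d) :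
    Integrable (fun x => M.φ x (π x) i) M.Px :=
  Integrable.of_bound
    ((measurable_pi_apply i).comp (measurable_feature hφ hπ)).aestronglyMeasurable 1
    (Filter.Eventually.of_forall fun x => abs_feature_le hbdd x (π x) i)

theorem integrable_feature_mul (hφ : ∀ a, Measurable fun x => M.φ x a)
    (hbdd : ∀ x a, ‖M.φ x a‖ ≤ 1) {π : X → A} (hπ : Measurable π) (i j : Fin d) :
    Integrable (fun x => M.φ x (π x) i * M.φ x (π x) j) M.Px := by
  have hm := fun i : Fin d => (measurable_pi_apply i).comp (measurable_feature hφ hπ)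
  refine Integrable.of_bound ((hm i).mul (hm j)).aestronglyMeasurable 1
    (Filter.Eventually.of_forall fun x => ?_)
  rw [Real.norm_eq_abs, abs_mul]
  exact mul_le_one₀ (abs_feature_le hbdd x (π x) i) (abs_nonneg _)
    (abs_feature_le hbdd x (π x) j)

theorem integrable_feature_quad (hφ : ∀ a, Measurable fun x => M.φ x a)
    (hbdd : ∀ x a, ‖M.φ x a‖ ≤ 1) {π : X → A} (hπ : Measurable π)
    (B : Matrix (Fin d) (Fin d) ℝ) :
    Integrable (fun x => (M.φ x (π x)).ofLp ⬝ᵥ B *ᵥ (M.φ x (π x)).ofLp) M.Px := by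
  simp only [dotProduct, Matrix.mulVec, Finset.mul_sum]
  refine integrable_finsetSum _ fun i _ => integrable_finsetSum _ fun j _ => ?_
  have := (integrable_feature_mul hφ hbdd hπ i j).const_mul (B i j)
  refine this.congr (Filter.Eventually.of_forall fun x => ?_)
  simp only
  ring

theorem integral_feature_quad (hφ : ∀ a, Measurable fun x => M.φ x a)
    (hbdd : ∀ x a, ‖M.φ x a‖ ≤ 1) {π : X → A} (hπ : Measurable π)
    (B : Matrix (Fin d) (Fin d) ℝ) :
    ∫ x, (M.φ x (π x)).ofLp ⬝ᵥ B *ᵥ (M.φ x (π x)).ofLp ∂M.Px = (B * M.popGram π).trace := by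
  have h1 : ∀ x, (M.φ x (π x)).ofLp ⬝ᵥ B *ᵥ (M.φ x (π x)).ofLp =
      ∑ i, ∑ j, B i j * (M.φ x (π x) j * M.φ x (π x) i) := by
    intro x
    simp only [dotProduct, Matrix.mulVec, Finset.mul_sum]
    refine Finset.sum_congr rfl fun i _ => Finset.sum_congr rfl fun j _ => ?_
    ring
  have hi := fun i j => (integrable_feature_mul hφ hbdd hπ j i).const_mul (B i j)
  simp_rw [h1]
  rw [integral_finsetSum _ fun i _ => integrable_finsetSum _ fun j _ => hi i j]
  simp_rw [integral_finsetSum _ fun j _ => hi _ j, integral_const_mul]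
  simp [Matrix.trace, Matrix.mul_apply, popGram]

theorem popGram_quad (hφ : ∀ a, Measurable fun x => M.φ x a)
    (hbdd : ∀ x a, ‖M.φ x a‖ ≤ 1) {π : X → A} (hπ : Measurable π) (y : Fin d → ℝ) :
    y ⬝ᵥ M.popGram π *ᵥ y = ∫ x, (y ⬝ᵥ (M.φ x (π x)).ofLp) ^ 2 ∂M.Px := by
  simp_rw [← vecMulVec_quad]
  rw [integral_feature_quad hφ hbdd hπ, Matrix.trace_mul_comm, Matrix.mul_vecMulVec,
    Matrix.trace_vecMulVec, dotProduct_comm]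

theorem popGram_posSemidef (hφ : ∀ a, Measurable fun x => M.φ x a)
    (hbdd : ∀ x a, ‖M.φ x a‖ ≤ 1) {π : X → A} (hπ : Measurable π) :
    (M.popGram π).PosSemidef := by
  refine Matrix.PosSemidef.of_dotProduct_mulVec_nonneg (popGram_isHermitian π) fun y => ?_
  rw [star_trivial, popGram_quad hφ hbdd hπ]
  exact integral_nonneg fun x => sq_nonneg _

/-- `G_* ≤ 1` because features have norm at most one. This lets prior precision, a multiple of the
identity, be compared with a multiple of `G_*`. -/
theorem popGram_quad_le (hφ : ∀ a, Measurable fun x => M.φ x a)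
    (hbdd : ∀ x a, ‖M.φ x a‖ ≤ 1) {π : X → A} (hπ : Measurable π) (y : Fin d → ℝ) :
    y ⬝ᵥ M.popGram π *ᵥ y ≤ y ⬝ᵥ y := by
  rw [popGram_quad hφ hbdd hπ]
  calc ∫ x, (y ⬝ᵥ (M.φ x (π x)).ofLp) ^ 2 ∂M.Px ≤ ∫ _, y ⬝ᵥ y ∂M.Px := by
        refine integral_mono_of_nonneg (Filter.Eventually.of_forall fun x => sq_nonneg _)
          (integrable_const _) (Filter.Eventually.of_forall fun x => ?_)
        refine (sq_dotProduct_le _ _).trans ?_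
        exact mul_le_of_le_one_right (sum_mul_self_nonneg y)
          (feature_dotProduct_self_le hbdd x (π x))
    _ = y ⬝ᵥ y := by simp

variable {S : Type*} [Fintype S] [DecidableEq S]

/-- On the event that all confidence intervals hold, the suboptimality of a policy that maximizes
the lower confidence bound is at most twice the expected confidence width of the competitor. -/
theorem value_gap_le (hφ : ∀ a, Measurable fun x => M.φ x a) (hbdd : ∀ x a, ‖M.φ x a‖ ≤ 1)
    {D : Dataset S X A} {s : S} (hV : (M.covPost D s).PosSemidef) {α : ℝ} (hα : 0 ≤ α)
    {πhat : S → X → A} (hhat : M.IsHierOPO D α πhat) {π : X → A} (hπ : Measurable π) {θ : Vec d}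
    (hθ : ∀ v : Fin d → ℝ,
      |v ⬝ᵥ (θ.ofLp - M.meanPost D s)| ≤ α * √(v ⬝ᵥ M.covPost D s *ᵥ v)) :
    M.value π θ - M.value (πhat s) θ ≤ 2 * α * √((M.covPost D s * M.popGram π).trace) := by
  have hint : ∀ {π' : X → A}, Measurable π' →
      Integrable (fun x => M.reward x (π' x) θ) M.Px := by
    intro π' hπ'
    simp_rw [reward_eq, dotProduct]
    exact integrable_finsetSum _ fun i _ => (integrable_feature hφ hbdd hπ' i).mul_const _
  obtain ⟨hs, hJ⟩ := integral_sqrt_le_sqrt_integral M.Px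
    (integrable_feature_quad hφ hbdd hπ (M.covPost D s))
    fun x => posSemidef_quad_nonneg hV _
  rw [integral_feature_quad hφ hbdd hπ] at hJ
  refine le_trans ?_ (mul_le_mul_of_nonneg_left hJ (by positivity))
  rw [value, value, ← integral_sub (hint hπ) (hint (hhat s).1), ← integral_const_mul]
  refine integral_mono ((hint hπ).sub (hint (hhat s).1)) (hs.const_mul _) fun x => ?_
  -- With `w` the confidence width, pointwise: the reward of `π` is at most its lower bound plus `2
  -- α w`, that lower bound is at most the one of `πhat`, and the latter is at most the reward of
  -- `πhat`.
  have h1 := (abs_le.1 (hθ (M.φ x (π x)).ofLp)).2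
  have h2 := (abs_le.1 (hθ (M.φ x (πhat s x)).ofLp)).1
  have h3 := (hhat s).2 x (π x)
  simp only [lcb] at h3
  simp only [reward_eq]
  rw [dotProduct_sub] at h1 h2
  linarith

end Features

end Model

/-! ### Scalar inequalities. -/

/-- Merging the two levels of the hierarchy into a single Gaussian with precision the parallel sum
of `κ` and `p`, and observing it with information `c`, is no worse than bounding the two levels
separately. -/
theorem inv_parallel_add_le {κ p c r : ℝ} (hκ : 0 < κ) (hp : 0 < p) (hc : 0 ≤ c) (hr : 0 ≤ r)
    (hrc : r ≤ c * κ / (κ + c)) :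
    (κ * p / (κ + p) + c)⁻¹ ≤ (κ + c)⁻¹ + (p + r)⁻¹ := by
  have h1 : (p + c * κ / (κ + c))⁻¹ ≤ (p + r)⁻¹ :=
    inv_anti₀ (by positivity) (by linarith)
  refine le_trans ?_ (add_le_add_right h1 _)
  have hW : 0 < κ * p + c * κ + c * p := by positivity
  have e1 : (κ * p / (κ + p) + c)⁻¹ = (κ + p) / (κ * p + c * κ + c * p) := by
    rw [show κ * p / (κ + p) + c = (κ * p + c * κ + c * p) / (κ + p) by field_simp; ring, inv_div]
  have e2 : (p + c * κ / (κ + c))⁻¹ = (κ + c) / (κ * p + c * κ + c * p) := by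
    rw [show p + c * κ / (κ + c) = (κ * p + c * κ + c * p) / (κ + c) by field_simp; ring, inv_div]
  -- With `W = κ p + c κ + c p`, the left side is `(κ + p) / W` and the hyper-parameter term is at
  -- least `(κ + c) / W`. The difference `(p - c) / W` is at most `1 / (κ + c)`, with slack `2 c κ +
  -- c²` after cross-multiplication.
  have e3 : (p - c) / (κ * p + c * κ + c * p) ≤ (κ + c)⁻¹ := by
    rw [inv_eq_one_div, div_le_div_iff₀ hW (by positivity)]
    nlinarith [mul_nonneg hc hκ.le, mul_nonneg hc hc]
  have e4 : (κ + p) / (κ * p + c * κ + c * p) =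
      (p - c) / (κ * p + c * κ + c * p) + (κ + c) / (κ * p + c * κ + c * p) := by
    rw [← add_div]; congr 1; ring
  rw [e1, e2, e4]
  linarith

theorem two_mul_sqrt_le {α τ a b d : ℝ} (hα : 0 ≤ α) (hd : 0 ≤ d) (ha : 0 ≤ a) (hb : 0 ≤ b)
    (h : τ ≤ (a⁻¹ + b⁻¹) * d) :
    2 * α * √τ ≤ α * √(4 * d / a) + α * √(4 * d / b) := by
  have h1 : √(4 * τ) = 2 * √τ := by
    rw [show (4 : ℝ) = 2 ^ 2 by norm_num, Real.sqrt_mul (by norm_num), Real.sqrt_sq (by norm_num)]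
  have h2 : √(4 * τ) ≤ √(4 * d / a) + √(4 * d / b) := by
    have ha' : 0 ≤ 4 * d / a := by positivity
    have hb' : 0 ≤ 4 * d / b := by positivity
    refine Real.sqrt_le_iff.2 ⟨by positivity, ?_⟩
    have h3 : 4 * τ ≤ 4 * d / a + 4 * d / b := by
      rw [div_eq_mul_inv, div_eq_mul_inv]
      linarith
    nlinarith [Real.sq_sqrt ha', Real.sq_sqrt hb',
      mul_nonneg (Real.sqrt_nonneg (4 * d / a)) (Real.sqrt_nonneg (4 * d / b))]
  calc 2 * α * √τ = α * √(4 * τ) := by rw [h1]; ring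
    _ ≤ α * (√(4 * d / a) + √(4 * d / b)) := mul_le_mul_of_nonneg_left h2 hα
    _ = _ := by ring

/-! ### The trace bound in the general case. -/

namespace Model

variable {d : ℕ} {S X A : Type*} [DecidableEq S] [MeasurableSpace X]
  {M : Model d X A} {D : Dataset S X A}
  {πstar : Vec d → X → A} {γ : ℝ}

/-- The exploration constant `γ σ⁻² n_z`. -/
def explore (M : Model d X A) (D : Dataset S X A) (γ : ℝ) (z : S) : ℝ :=
  γ * (M.σ ^ 2)⁻¹ * D.count z

theorem explore_nonneg (hγ : 0 < γ) (z : S) : 0 ≤ M.explore D γ z := by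
  unfold explore; positivity

theorem explore_pos (hσ : 0 < M.σ) (hγ : 0 < γ) {z : S} (hz : D.count z ≠ 0) :
    0 < M.explore D γ z := by
  have : (0 : ℝ) < D.count z := by exact_mod_cast Nat.pos_of_ne_zero hz
  unfold explore; positivity

theorem inv_explore (z : S) :
    (M.explore D γ z)⁻¹ = γ⁻¹ * M.σ ^ 2 * (D.count z : ℝ)⁻¹ := by
  rw [explore, mul_inv, mul_inv, inv_inv]

theorem WellExplored.quad_le (hγ : M.WellExplored D πstar γ) (z : S) (θ : Vec d)
    (y : Fin d → ℝ) :
    M.explore D γ z * (y ⬝ᵥ M.popGram (πstar θ) *ᵥ y) ≤ y ⬝ᵥ M.gram D z *ᵥ y := by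
  have := quad_le_of_posSemidef (hγ.2 z θ) y
  rwa [Matrix.smul_mulVec, dotProduct_smul, smul_eq_mul] at this

/-- The summand of task `z` in the hyper-parameter term. -/
def hyperSummand (M : Model d X A) (D : Dataset S X A) (γ : ℝ) (π : X → A) (z : S) : ℝ :=
  open Classical in
  if D.count z = 0 ∨ ¬ IsUnit (M.popGram π) then 0 else
    1 / (lamMax M.cov0 + γ⁻¹ * M.σ ^ 2 * lamMax (M.popGram π)⁻¹ * (D.count z : ℝ)⁻¹)

variable [Finite A] [MeasurableSpace A] [MeasurableSingletonClass A] [IsProbabilityMeasure M.Px]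

/-- Isolates the convention `1/∞ = 0`. Otherwise `l = λ₁(G_*⁻¹)`, and `l ≥ 1` because `G_* ≤ 1`. -/
theorem hyperSummand_cases (hd : 0 < d) (hφ : ∀ a, Measurable fun x => M.φ x a)
    (hbdd : ∀ x a, ‖M.φ x a‖ ≤ 1) (hσ : 0 < M.σ) (hγ : 0 < γ) {π : X → A} (hπ : Measurable π)
    (z : S) : M.hyperSummand D γ π z = 0 ∨
      0 < M.explore D γ z ∧ ∃ l : ℝ, 1 ≤ l ∧ (∀ y, y ⬝ᵥ y ≤ l * (y ⬝ᵥ M.popGram π *ᵥ y)) ∧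
        M.hyperSummand D γ π z = (lamMax M.cov0 + l * (M.explore D γ z)⁻¹)⁻¹ := by
  by_cases h : D.count z = 0 ∨ ¬ IsUnit (M.popGram π)
  · left
    rw [hyperSummand, if_pos h]
  right
  have hval : M.hyperSummand D γ π z = 1 / (lamMax M.cov0 +
      γ⁻¹ * M.σ ^ 2 * lamMax (M.popGram π)⁻¹ * (D.count z : ℝ)⁻¹) := by
    rw [hyperSummand, if_neg h]
  push Not at h
  have hP : (M.popGram π).PosDef :=
    (popGram_posSemidef hφ hbdd hπ).posDef_iff_isUnit.2 h.2
  have hinv := inv_lamMax_mul_le_quad_inv hd hP.inv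
  rw [Matrix.nonsing_inv_nonsing_inv _ ((Matrix.isUnit_iff_isUnit_det _).1 h.2)] at hinv
  have hl := lamMax_pos hd hP.inv
  have hle : ∀ y, y ⬝ᵥ y ≤ lamMax (M.popGram π)⁻¹ * (y ⬝ᵥ M.popGram π *ᵥ y) := by
    intro y
    have := hinv y
    rwa [inv_mul_le_iff₀ hl] at this
  refine ⟨explore_pos hσ hγ h.1, lamMax (M.popGram π)⁻¹, ?_, hle, ?_⟩
  · have h1 := hle (Pi.single ⟨0, hd⟩ 1)
    have h2 := popGram_quad_le hφ hbdd hπ (Pi.single ⟨0, hd⟩ 1)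
    have h3 : (Pi.single ⟨0, hd⟩ 1 : Fin d → ℝ) ⬝ᵥ Pi.single ⟨0, hd⟩ 1 = 1 := by simp
    rw [h3] at h1 h2
    nlinarith
  · rw [hval, inv_explore, one_div]
    ring_nf

theorem hyperSummand_nonneg (hd : 0 < d) (hφ : ∀ a, Measurable fun x => M.φ x a)
    (hbdd : ∀ x a, ‖M.φ x a‖ ≤ 1) (hcov0 : M.cov0.PosDef) (hσ : 0 < M.σ) (hγ : 0 < γ)
    {π : X → A} (hπ : Measurable π) (z : S) : 0 ≤ M.hyperSummand D γ π z := by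
  have hK := lamMax_pos hd hcov0
  rcases hyperSummand_cases (D := D) hd hφ hbdd hσ hγ hπ z with h | ⟨hc, l, hl, -, h⟩
  · exact h.ge
  · rw [h]; positivity

theorem hyperSummand_mul_le (hd : 0 < d) (hφ : ∀ a, Measurable fun x => M.φ x a)
    (hbdd : ∀ x a, ‖M.φ x a‖ ≤ 1) (hcov0 : M.cov0.PosDef) (hσ : 0 < M.σ)
    (hstar : ∀ θ, Measurable (πstar θ)) (hγ : M.WellExplored D πstar γ) (z : S) (θ : Vec d)
    (y : Fin d → ℝ) :
    M.hyperSummand D γ (πstar θ) z * (y ⬝ᵥ y) ≤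
      y ⬝ᵥ infoMat M.cov0⁻¹ (M.gram D z) *ᵥ y := by
  have hK := lamMax_pos hd hcov0
  rcases hyperSummand_cases (D := D) hd hφ hbdd hσ hγ.1 (hstar θ) z with h | ⟨hc, l, hl, hle, h⟩
  · rw [h, zero_mul]
    exact posSemidef_quad_nonneg (infoMat_posSemidef hcov0.inv (M.gram_posSemidef D z)) y
  · have hl0 : 0 < l := by linarith
    -- The parallel sum of `1 / λ₁(Σ₀)` and `explore / l` is precisely the summand; the second
    -- number is a lower bound for `G_z` by exploration and `1 ≤ l G_*`.
    have h1 := infoMat_quad_ge hcov0.inv (M.gram_posSemidef D z) (inv_pos.2 hK)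
      (g := M.explore D γ z / l) (by positivity) (inv_lamMax_mul_le_quad_inv hd hcov0)
      (fun y => by
        refine le_trans ?_ (hγ.quad_le z θ y)
        rw [div_mul_eq_mul_div, div_le_iff₀ hl0, mul_assoc, mul_comm _ l]
        exact mul_le_mul_of_nonneg_left (hle y) hc.le) y
    refine le_trans (le_of_eq ?_) h1
    rw [h]
    congr 1
    field_simp
    rw [add_comm]

/-- Supplies the hypothesis on `r` in `inv_parallel_add_le`. Task `s` is left out of `P`, so its
summand must be recovered from its own exploration constant; this uses `1 / λ_d(Σ₀⁻¹) ≤ λ₁(Σ₀)` and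
`l ≥ 1`. -/
theorem hyperSummand_le (hd : 0 < d) (hφ : ∀ a, Measurable fun x => M.φ x a)
    (hbdd : ∀ x a, ‖M.φ x a‖ ≤ 1) (hcov0 : M.cov0.PosDef) (hσ : 0 < M.σ) (hγ : 0 < γ)
    {π : X → A} (hπ : Measurable π) (z : S) :
    M.hyperSummand D γ π z ≤
      M.explore D γ z * lamMin M.cov0⁻¹ / (lamMin M.cov0⁻¹ + M.explore D γ z) := by
  have hκ := lamMin_pos hd hcov0.inv
  have hK := lamMax_pos hd hcov0
  have hKκ := inv_lamMax_le_lamMin_inv hd hcov0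
  rcases hyperSummand_cases (D := D) hd hφ hbdd hσ hγ hπ z with h | ⟨hc, l, hl, hle, h⟩
  · rw [h]
    have := explore_nonneg (M := M) (D := D) hγ z
    positivity
  · rw [h]
    have e : M.explore D γ z * lamMin M.cov0⁻¹ / (lamMin M.cov0⁻¹ + M.explore D γ z) =
        ((lamMin M.cov0⁻¹)⁻¹ + (M.explore D γ z)⁻¹)⁻¹ := by
      field_simp
      rw [add_comm]
    rw [e]
    refine inv_anti₀ (by positivity) (add_le_add ?_ ?_)
    · exact inv_le_of_inv_le₀ hK hKκ
    · exact le_mul_of_one_le_left (by positivity) hl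

variable [Fintype S]

theorem trace_covPost_le (hd : 0 < d) (hφ : ∀ a, Measurable fun x => M.φ x a)
    (hbdd : ∀ x a, ‖M.φ x a‖ ≤ 1) (hcovQ : M.covQ.PosDef) (hcov0 : M.cov0.PosDef) (hσ : 0 < M.σ)
    (hstar : ∀ θ, Measurable (πstar θ)) (hγ : M.WellExplored D πstar γ) (s : S)
    (θ : S → Vec d) :
    (M.covPost D s * M.popGram (πstar (θ s))).trace ≤
      ((lamMin M.cov0⁻¹ + M.explore D γ s)⁻¹ +
        (lamMin M.covQ⁻¹ + ∑ z, M.hyperSummand D γ (πstar (θ z)) z)⁻¹) * d := by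
  set r : S → ℝ := fun z => M.hyperSummand D γ (πstar (θ z)) z with hr
  have hr0 : ∀ z, 0 ≤ r z := fun z => hyperSummand_nonneg hd hφ hbdd hcov0 hσ hγ.1 (hstar _) z
  set I : S → Matrix (Fin d) (Fin d) ℝ := fun z => infoMat M.cov0⁻¹ (M.gram D z) with hI
  have hIp : ∀ z, (I z).PosSemidef := fun z =>
    infoMat_posSemidef hcov0.inv (M.gram_posSemidef D z)
  have hIr : ∀ z y, r z * (y ⬝ᵥ y) ≤ y ⬝ᵥ I z *ᵥ y := fun z y =>
    hyperSummand_mul_le hd hφ hbdd hcov0 hσ hstar hγ z (θ z) y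
  -- The precision of `μ_*` without the data of task `s`, which enter only through `gram D s` in
  -- `hV`.
  set P := M.covQ⁻¹ + ∑ z ∈ Finset.univ.erase s, I z with hPdef
  have hP : P.PosDef :=
    hcovQ.inv.add_posSemidef (Matrix.posSemidef_sum _ fun z _ => hIp z)
  set p := lamMin M.covQ⁻¹ + ∑ z ∈ Finset.univ.erase s, r z with hpdef
  have hp : 0 < p :=
    add_pos_of_pos_of_nonneg (lamMin_pos hd hcovQ.inv) (Finset.sum_nonneg fun z _ => hr0 z)
  have hPp : ∀ y, p * (y ⬝ᵥ y) ≤ y ⬝ᵥ P *ᵥ y := by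
    intro y
    rw [hpdef, hPdef, add_mul, Matrix.add_mulVec, dotProduct_add, Finset.sum_mul,
      Matrix.sum_mulVec, dotProduct_sum]
    exact add_le_add (lamMin_mul_le hcovQ.inv.1 y) (Finset.sum_le_sum fun z _ => hIr z y)
  set κ := lamMin M.cov0⁻¹ with hκdef
  have hκ : 0 < κ := lamMin_pos hd hcov0.inv
  set c := M.explore D γ s with hcdef
  have hc : 0 ≤ c := explore_nonneg hγ.1 s
  have hV : M.covPost D s = (infoMat M.cov0⁻¹ P + M.gram D s)⁻¹ := by
    rw [← woodbury_posterior hP hcov0.inv (M.gram_posSemidef D s), covPost, covTask,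
      covHyper_eq M D hcov0, hPdef, add_assoc (M.covQ⁻¹), Finset.sum_erase_add _ _
      (Finset.mem_univ s)]
  have hNp : (infoMat M.cov0⁻¹ P + M.gram D s).PosDef := by
    have := (M.covPost_posDef D hcovQ hcov0 s)
    rw [hV] at this
    exact Matrix.posDef_inv_iff.1 this
  have hG := popGram_posSemidef hφ hbdd (hstar (θ s))
  have hm : 0 < κ * p / (κ + p) := by positivity
  -- Prior precision dominates `κ p / (κ + p)` times the identity, hence times `G_*`; the data of
  -- task `s` dominate `c G_*`. The multiples of `G_*` add up.
  have htr := trace_inv_mul_le hNp hG.1 (v := (κ * p / (κ + p) + c)⁻¹) fun y => by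
    rw [le_inv_mul_iff₀ (by positivity), add_mul, Matrix.add_mulVec, dotProduct_add]
    refine add_le_add ?_ (hγ.quad_le s (θ s) y)
    refine le_trans (mul_le_mul_of_nonneg_left (popGram_quad_le hφ hbdd (hstar (θ s)) y) hm.le) ?_
    exact infoMat_quad_ge hcov0.inv hP.posSemidef hκ hp (lamMin_mul_le hcov0.inv.1) hPp y
  rw [hV]
  refine htr.trans (mul_le_mul_of_nonneg_right ?_ (Nat.cast_nonneg d))
  have hsum : lamMin M.covQ⁻¹ + ∑ z, r z = p + r s := by
    rw [hpdef, add_assoc, Finset.sum_erase_add _ _ (Finset.mem_univ s)]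
  rw [hsum]
  exact inv_parallel_add_le hκ hp hc (hr0 s)
    (hyperSummand_le hd hφ hbdd hcov0 hσ hγ.1 (hstar (θ s)) s)

end Model

/-! ### The diagonal case. -/

theorem quad_single {d : ℕ} (A : Matrix (Fin d) (Fin d) ℝ) (i : Fin d) :
    (Pi.single i 1 : Fin d → ℝ) ⬝ᵥ A *ᵥ Pi.single i 1 = A i i := by
  simp

theorem single_dotProduct_self {d : ℕ} (i : Fin d) :
    (Pi.single i 1 : Fin d → ℝ) ⬝ᵥ Pi.single i 1 = 1 := by
  simp

theorem diagonal_inv_of_ne_zero {d : ℕ} {v : Fin d → ℝ} (hv : ∀ i, v i ≠ 0) :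
    (Matrix.diagonal v)⁻¹ = Matrix.diagonal fun i => (v i)⁻¹ := by
  apply Matrix.inv_eq_left_inv
  rw [Matrix.diagonal_mul_diagonal, ← Matrix.diagonal_one]
  congr 1
  funext i
  exact inv_mul_cancel₀ (hv i)

theorem exists_inv_eq_diagonal {d : ℕ} {A : Matrix (Fin d) (Fin d) ℝ} (hA : A.PosDef)
    (hD : A.IsDiag) : ∃ v : Fin d → ℝ, A⁻¹ = Matrix.diagonal v := by
  refine ⟨fun i => (A i i)⁻¹, ?_⟩
  conv_lhs => rw [← hD.diagonal_diag]
  exact diagonal_inv_of_ne_zero fun i => (hA.diag_pos (i := i)).ne'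

/-- Scaling the parallel sum of `K⁻¹` and `e` by `p ≤ 1` bounds the parallel sum of `c ≥ K⁻¹` and
`g ≥ e p` from below. -/
theorem mul_parallel_le {K e p c g : ℝ} (hK : 0 < K) (he : 0 < e) (hp : 0 ≤ p) (hp1 : p ≤ 1)
    (hc : K⁻¹ ≤ c) (hg : e * p ≤ g) : p * (K + e⁻¹)⁻¹ ≤ c - c * (c + g)⁻¹ * c := by
  have hc0 : 0 < c := (inv_pos.2 hK).trans_le hc
  rcases hp.eq_or_lt with rfl | hp0
  · have hg0 : 0 ≤ g := by simpa using hg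
    have : c * (c + g)⁻¹ ≤ 1 := by
      rw [← div_eq_mul_inv, div_le_one (by positivity)]; linarith
    nlinarith
  · have hg0 : 0 < g := lt_of_lt_of_le (by positivity) hg
    have h1 : c - c * (c + g)⁻¹ * c = (c⁻¹ + g⁻¹)⁻¹ := by field_simp; ring
    have h2 : p * (K + e⁻¹)⁻¹ = (K / p + (e * p)⁻¹)⁻¹ := by field_simp
    rw [h1, h2]
    refine inv_anti₀ (by positivity) (add_le_add ?_ (inv_anti₀ (by positivity) hg))
    refine (inv_le_of_inv_le₀ hK hc).trans ?_
    rw [le_div_iff₀ hp0]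
    nlinarith

namespace Model

variable {d : ℕ} {S X A : Type*} [DecidableEq S] [MeasurableSpace X]
  {M : Model d X A} {D : Dataset S X A} {πstar : Vec d → X → A} {γ : ℝ}

theorem gram_isDiag (h : ∀ x a i j, M.φ x a i ≠ 0 → M.φ x a j ≠ 0 → i = j) (z : S) :
    (M.gram D z).IsDiag := by
  refine Matrix.IsDiag.smul _ fun i j hij => ?_
  beta_reduce
  rw [Matrix.sum_apply]
  refine Finset.sum_eq_zero fun t _ => ?_
  split_ifs
  · rw [Matrix.vecMulVec_apply]
    by_contra hne
    exact hij (h _ _ _ _ (left_ne_zero_of_mul hne) (right_ne_zero_of_mul hne))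
  · rfl

/-- The summand of task `z` in the hyper-parameter term of the diagonal case. -/
def hyperSummandDiag (M : Model d X A) (D : Dataset S X A) (γ : ℝ) (z : S) : ℝ :=
  if D.count z = 0 then 0 else
    1 / (lamMax M.cov0 + γ⁻¹ * M.σ ^ 2 * (D.count z : ℝ)⁻¹)

theorem hyperSummandDiag_nonneg (hd : 0 < d) (hcov0 : M.cov0.PosDef) (hγ : 0 < γ) (z : S) :
    0 ≤ M.hyperSummandDiag D γ z := by
  have hK := lamMax_pos hd hcov0
  unfold hyperSummandDiag
  split_ifs <;> positivity

theorem mul_hyperSummandDiag_le (hd : 0 < d) (hcov0 : M.cov0.PosDef) (hσ : 0 < M.σ)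
    (hγ : 0 < γ) (z : S) {p c g : ℝ} (hp : 0 ≤ p) (hp1 : p ≤ 1) (hc : (lamMax M.cov0)⁻¹ ≤ c)
    (hg : M.explore D γ z * p ≤ g) :
    p * M.hyperSummandDiag D γ z ≤ c - c * (c + g)⁻¹ * c := by
  have hK := lamMax_pos hd hcov0
  by_cases hz : D.count z = 0
  · rw [hyperSummandDiag, if_pos hz, mul_zero]
    have hg0 : 0 ≤ g := le_trans (mul_nonneg (explore_nonneg hγ z) hp) hg
    -- Without data only nonnegativity is needed, which is the case `p = 0`; the value `1` for `e`
    -- is arbitrary.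
    have := mul_parallel_le hK one_pos le_rfl zero_le_one hc (g := g) (by simpa using hg0)
    simpa using this
  · rw [hyperSummandDiag, if_neg hz, one_div, ← inv_explore]
    exact mul_parallel_le hK (explore_pos hσ hγ hz) hp hp1 hc hg

variable [Finite A] [MeasurableSpace A] [MeasurableSingletonClass A] [IsProbabilityMeasure M.Px]
  [Fintype S]

theorem trace_covPost_le_of_diagonal (hd : 0 < d) (hφ : ∀ a, Measurable fun x => M.φ x a)
    (hbdd : ∀ x a, ‖M.φ x a‖ ≤ 1) (hcovQ : M.covQ.PosDef) (hcov0 : M.cov0.PosDef) (hσ : 0 < M.σ)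
    (hstar : ∀ θ, Measurable (πstar θ)) (hγ : M.WellExplored D πstar γ)
    (hdiag : M.DiagonalCase) (s : S) (θ : Vec d) :
    (M.covPost D s * M.popGram (πstar θ)).trace ≤
      ((lamMin M.cov0⁻¹ + M.explore D γ s)⁻¹ +
        (lamMin M.covQ⁻¹ + ∑ z, M.hyperSummandDiag D γ z)⁻¹) * d := by
  have hG := popGram_posSemidef hφ hbdd (hstar θ)
  have hκ : 0 < lamMin M.cov0⁻¹ := lamMin_pos hd hcov0.inv
  have hc : 0 ≤ M.explore D γ s := explore_nonneg hγ.1 s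
  have h1 : (M.covTask D s * M.popGram (πstar θ)).trace ≤
      (lamMin M.cov0⁻¹ + M.explore D γ s)⁻¹ * d := by
    refine trace_inv_mul_le (M.covTask_inv_posDef D hcov0 s) hG.1 fun y => ?_
    rw [le_inv_mul_iff₀ (by positivity), add_mul, Matrix.add_mulVec, dotProduct_add]
    refine add_le_add ?_ (hγ.quad_le s θ y)
    exact (mul_le_mul_of_nonneg_left (popGram_quad_le hφ hbdd (hstar θ) y) hκ.le).trans
      (lamMin_mul_le hcov0.inv.1 y)
  have h2 : (M.covTask D s * M.cov0⁻¹ * M.covHyper D * M.cov0⁻¹ * M.covTask D s *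
      M.popGram (πstar θ)).trace ≤
      (lamMin M.covQ⁻¹ + ∑ z, M.hyperSummandDiag D γ z)⁻¹ * d := by
    obtain ⟨q, hq⟩ := exists_inv_eq_diagonal hcovQ hdiag.2.1
    obtain ⟨c, hc⟩ := exists_inv_eq_diagonal hcov0 hdiag.2.2
    set g : S → Fin d → ℝ := fun z => (M.gram D z).diag with hg
    have hgram : ∀ z, M.gram D z = Matrix.diagonal (g z) := fun z =>
      (gram_isDiag hdiag.1 z).diagonal_diag.symm
    have hg0 : ∀ z i, 0 ≤ g z i := fun z i => (M.gram_posSemidef D z).diag_nonneg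
    have hcK : ∀ i, (lamMax M.cov0)⁻¹ ≤ c i := fun i => by
      have := inv_lamMax_mul_le_quad_inv hd hcov0 (Pi.single i 1)
      rwa [quad_single, single_dotProduct_self, mul_one, hc, Matrix.diagonal_apply_eq] at this
    have hc0 : ∀ i, 0 < c i := fun i => (inv_pos.2 (lamMax_pos hd hcov0)).trans_le (hcK i)
    have hqQ : ∀ i, lamMin M.covQ⁻¹ ≤ q i := fun i => by
      have := lamMin_mul_le hcovQ.inv.1 (Pi.single i 1)
      rwa [quad_single, single_dotProduct_self, mul_one, hq, Matrix.diagonal_apply_eq, ← hq] at this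
    set p : Fin d → ℝ := (M.popGram (πstar θ)).diag with hp
    have hp0 : ∀ i, 0 ≤ p i := fun i => hG.diag_nonneg
    have hp1 : ∀ i, p i ≤ 1 := fun i => by
      have := popGram_quad_le hφ hbdd (hstar θ) (Pi.single i 1)
      rwa [quad_single, single_dotProduct_self] at this
    -- Exploration is applied to every task `z` at the single parameter `θ`, which is the one of
    -- task `s`. Thus the same weights `p i` appear in all summands.
    have hgp : ∀ z i, M.explore D γ z * p i ≤ g z i := fun z i => by
      have := hγ.quad_le z θ (Pi.single i 1)
      rwa [quad_single, quad_single] at this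
    have hTi : ∀ z, (M.cov0⁻¹ + M.gram D z)⁻¹ =
        Matrix.diagonal fun i => (c i + g z i)⁻¹ := fun z => by
      rw [hc, hgram, Matrix.diagonal_add, diagonal_inv_of_ne_zero fun i =>
        (add_pos_of_pos_of_nonneg (hc0 i) (hg0 z i)).ne']
    set w : Fin d → ℝ := fun i => q i + ∑ z, (c i - c i * (c i + g z i)⁻¹ * c i) with hw
    set Δ := lamMin M.covQ⁻¹ + ∑ z, M.hyperSummandDiag D γ z with hΔdef
    have hΔ : 0 < Δ := add_pos_of_pos_of_nonneg (lamMin_pos hd hcovQ.inv)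
      (Finset.sum_nonneg fun z _ => hyperSummandDiag_nonneg hd hcov0 hγ.1 z)
    have hinfo : ∀ z, infoMat M.cov0⁻¹ (M.gram D z) =
        Matrix.diagonal fun i => c i - c i * (c i + g z i)⁻¹ * c i := fun z => by
      rw [infoMat, hTi, hc, Matrix.diagonal_mul_diagonal, Matrix.diagonal_mul_diagonal,
        Matrix.diagonal_sub]
    have hterm : ∀ z i, p i * M.hyperSummandDiag D γ z ≤ c i - c i * (c i + g z i)⁻¹ * c i :=
      fun z i => mul_hyperSummandDiag_le hd hcov0 hσ hγ.1 z (hp0 i) (hp1 i) (hcK i) (hgp z i)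
    have hterm0 : ∀ z i, 0 ≤ c i - c i * (c i + g z i)⁻¹ * c i := fun z i => by
      simpa using mul_hyperSummandDiag_le (D := D) (g := g z i) hd hcov0 hσ hγ.1 z le_rfl
        zero_le_one (hcK i) (by simpa using hg0 z i)
    have hw0 : ∀ i, 0 < w i := fun i => add_pos_of_pos_of_nonneg
      ((lamMin_pos hd hcovQ.inv).trans_le (hqQ i)) (Finset.sum_nonneg fun z _ => hterm0 z i)
    have hH : M.covHyper D = Matrix.diagonal fun i => (w i)⁻¹ := by
      rw [covHyper_eq M D hcov0, ← diagonal_inv_of_ne_zero fun i => (hw0 i).ne']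
      congr 1
      simp_rw [hinfo]
      rw [hq]
      ext i j
      by_cases hij : i = j
      · subst hij
        simp [Matrix.sum_apply, hw]
      · simp [Matrix.sum_apply, hij]
    -- The weight `p i ≤ 1` multiplies the whole hyper-precision, so a coordinate poorly covered by
    -- `G_*` is discounted in the trace to the same extent. No inverse of `G_*` is needed.
    have hpw : ∀ i, p i * Δ ≤ w i := fun i => by
      rw [hΔdef, mul_add, Finset.mul_sum]
      refine add_le_add ?_ (Finset.sum_le_sum fun z _ => hterm z i)
      exact (mul_le_of_le_one_left (lamMin_pos hd hcovQ.inv).le (hp1 i)).trans (hqQ i)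
    rw [covTask, hTi, hH, hc]
    simp only [Matrix.diagonal_mul_diagonal]
    have htr : ∀ v : Fin d → ℝ, (Matrix.diagonal v * M.popGram (πstar θ)).trace =
        ∑ i, v i * p i := by
      intro v
      simp [Matrix.trace, hp]
    rw [htr]
    -- Each coordinate contributes the squared shrinkage `(c / (c + g))² ≤ 1` times `p / w ≤ 1 / Δ`.
    calc _ ≤ ∑ _i : Fin d, Δ⁻¹ := by
          refine Finset.sum_le_sum fun i _ => ?_
          have ht0 : 0 ≤ (c i + g s i)⁻¹ * c i :=
            mul_nonneg (inv_nonneg.2 (add_nonneg (hc0 i).le (hg0 s i))) (hc0 i).le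
          have ht1 : (c i + g s i)⁻¹ * c i ≤ 1 := by
            rw [inv_mul_le_iff₀ (add_pos_of_pos_of_nonneg (hc0 i) (hg0 s i))]
            linarith [hg0 s i]
          have hpwi : (w i)⁻¹ * p i ≤ Δ⁻¹ := by
            rw [inv_mul_le_iff₀ (hw0 i), ← div_eq_mul_inv, le_div_iff₀ hΔ]
            exact hpw i
          have hpw0 : 0 ≤ (w i)⁻¹ * p i := mul_nonneg (inv_nonneg.2 (hw0 i).le) (hp0 i)
          calc _ = ((c i + g s i)⁻¹ * c i) ^ 2 * ((w i)⁻¹ * p i) := by ring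
            _ ≤ 1 * ((w i)⁻¹ * p i) :=
              mul_le_mul_of_nonneg_right (pow_le_one₀ ht0 ht1) hpw0
            _ ≤ Δ⁻¹ := by rw [one_mul]; exact hpwi
      _ = Δ⁻¹ * d := by simp [mul_comm]
  rw [covPost, Matrix.add_mul, Matrix.trace_add, add_mul]
  exact add_le_add h1 h2

/-! ### From the trace bound to the theorem. -/

/-- A bound on the posterior variance of the optimal actions turns into a high-probability bound
on the suboptimality of the policy. -/
theorem posterior_gap_ge (hφ : ∀ a, Measurable fun x => M.φ x a)
    (hcovQ : M.covQ.PosDef) (hcov0 : M.cov0.PosDef) (hσ : 0 < M.σ) (hbdd : ∀ x a, ‖M.φ x a‖ ≤ 1)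
    (hstar : ∀ θ, Measurable (πstar θ)) (hγ : 0 < γ) {δ : ℝ} (hδ0 : 0 < δ)
    (hδ1 : δ ≤ Real.exp (-1)) {α : ℝ} (hα : α = √(5 * d * Real.log (1 / δ)))
    {πhat : S → X → A} (hhat : M.IsHierOPO D α πhat) (s : S) {r : (S → Vec d) → S → ℝ}
    (hr0 : 0 < d → ∀ θ z, 0 ≤ r θ z)
    (hr : 0 < d → ∀ θ : S → Vec d, (M.covPost D s * M.popGram (πstar (θ s))).trace ≤
      ((lamMin M.cov0⁻¹ + M.explore D γ s)⁻¹ + (lamMin M.covQ⁻¹ + ∑ z, r θ z)⁻¹) * d) :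
    ENNReal.ofReal (1 - δ) ≤
      M.posterior D {p | M.value (πstar (p.2 s)) (p.2 s) - M.value (πhat s) (p.2 s)
        ≤ M.taskTerm D α γ s + α * √(4 * d / (lamMin M.covQ⁻¹ + ∑ z, r p.2 z))} := by
  have ht : 1 ≤ Real.log (1 / δ) := by
    rw [one_div, Real.log_inv, le_neg]
    simpa using Real.log_le_log hδ0 hδ1
  have hexp : Real.exp (-Real.log (1 / δ)) = δ := by
    rw [one_div, Real.log_inv, neg_neg, Real.exp_log hδ0]
  have hconc := M.posterior_concentration D hcovQ hcov0 hσ s ht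
  rw [hexp, ← hα] at hconc
  have hα0 : 0 ≤ α := by rw [hα]; exact Real.sqrt_nonneg _
  refine hconc.trans (measure_mono fun p hp => ?_)
  have hgap := value_gap_le hφ hbdd (M.covPost_posDef D hcovQ hcov0 s).posSemidef hα0 hhat
    (hstar (p.2 s)) hp
  refine hgap.trans ?_
  -- In dimension zero `α = 0`, so both sides vanish; the eigenvalue bounds require `0 < d`.
  rcases Nat.eq_zero_or_pos d with hd | hd
  · have : α = 0 := by rw [hα, hd]; simp
    simp [this, taskTerm]
  · exact two_mul_sqrt_le hα0 (Nat.cast_nonneg d)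
      (add_pos_of_pos_of_nonneg (lamMin_pos hd hcov0.inv) (explore_nonneg hγ s)).le
      (add_pos_of_pos_of_nonneg (lamMin_pos hd hcovQ.inv)
        (Finset.sum_nonneg fun z _ => hr0 hd p.2 z)).le (hr hd p.2)

end Model

end HierOPO

end

theorem theorem2 {d : ℕ} {S X A : Type*} [Fintype S] [DecidableEq S] [MeasurableSpace X]
    [Finite A] [MeasurableSpace A] [MeasurableSingletonClass A]
    (M : HierOPO.Model d X A) [IsProbabilityMeasure M.Px]
    (hφ : ∀ a, Measurable fun x => M.φ x a)
    (hcovQ : M.covQ.PosDef) (hcov0 : M.cov0.PosDef) (hσ : 0 < M.σ)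
    -- bounded features
    (hbdd : ∀ x a, ‖M.φ x a‖ ≤ 1)
    (D : HierOPO.Dataset S X A)
    -- the optimal policy as a (measurable) function of the task parameter
    (πstar : HierOPO.Vec d → X → A)
    (hstar : ∀ θ, M.IsOptimal (πstar θ) θ)
    (hstar_meas : Measurable fun p : HierOPO.Vec d × X => πstar p.1 p.2)
    (γ : ℝ) (hγ : M.WellExplored D πstar γ)
    (δ : ℝ) (hδ0 : 0 < δ) (hδ1 : δ ≤ Real.exp (-1))
    (α : ℝ) (hα : α = √(5 * d * Real.log (1 / δ)))
    (πhat : S → X → A) (hhat : M.IsHierOPO D α πhat) (s : S) :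
    (ENNReal.ofReal (1 - δ) ≤
      M.posterior D {p | M.value (πstar (p.2 s)) (p.2 s) - M.value (πhat s) (p.2 s)
        ≤ M.taskTerm D α γ s + M.hyperTerm D πstar α γ p.2}) ∧
    (M.DiagonalCase →
      ENNReal.ofReal (1 - δ) ≤
        M.posterior D {p | M.value (πstar (p.2 s)) (p.2 s) - M.value (πhat s) (p.2 s)
          ≤ M.taskTerm D α γ s + M.hyperTermDiag D α γ}) := by
  have hm : ∀ θ, Measurable (πstar θ) := fun θ => (hstar θ).1
  exact ⟨HierOPO.Model.posterior_gap_ge hφ hcovQ hcov0 hσ hbdd hm hγ.1 hδ0 hδ1 hα hhat s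
      (r := fun θ z => M.hyperSummand D γ (πstar (θ z)) z)
      (fun hd θ z => HierOPO.Model.hyperSummand_nonneg hd hφ hbdd hcov0 hσ hγ.1 (hm _) z)
      (fun hd θ => HierOPO.Model.trace_covPost_le hd hφ hbdd hcovQ hcov0 hσ hm hγ s θ),
    fun hdiag => HierOPO.Model.posterior_gap_ge hφ hcovQ hcov0 hσ hbdd hm hγ.1 hδ0 hδ1 hα hhat s
      (r := fun _ z => M.hyperSummandDiag D γ z)
      (fun hd _ z => HierOPO.Model.hyperSummandDiag_nonneg hd hcov0 hγ.1 z)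
      (fun hd θ => HierOPO.Model.trace_covPost_le_of_diagonal hd hφ hbdd hcovQ hcov0 hσ hm hγ
        hdiag s (θ s))⟩
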